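/- Let $K$ be a quadratic number field and let $L/K$ be a finite Galois extension of degree $n$ that is unramified at every nonzero prime ideal not lying above $2$. Suppose that the ramification index over $K$ of the primes of $L$ above $2$ is $e2^m$ with $e$ odd and $m\ge 1$, and that $\mathrm{Gal}(L/K)$ embeds into $\mathrm{GL}_2(\mathbb F_{2^a})$ for some $a\ge 1$. Let $d_K$ and $d_L$ be the absolute discriminants of $K$ and $L$. (a) If $2$ ramifies in $K$, then $|d_L|\le |d_K|^n\,2^{2cn}$ for some real number $c\le \frac94-\frac1{2^{m-1}}$. (b) If $2$ is inert in $K$, then $|d_L|\le |d_K|^n\,2^{2cn}$ for some real number $c\le 3-\frac1{2^{m-1}}-\frac1{e2^m}$. -/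

import Mathlib

open NumberField

/-- The rational prime `2` ramifies in the number field `K`: some prime ideal of `𝓞 K` containing
`2` has ramification index greater than `1` over `ℤ`. -/
def TwoRamifiesIn (K : Type*) [Field K] [NumberField K] : Prop :=
  ∃ p : Ideal (𝓞 K), p.IsPrime ∧ (2 : 𝓞 K) ∈ p ∧
    1 < Ideal.ramificationIdx p ℤ

/-- The rational prime `2` stays prime in the number field `K`; when `[K : ℚ] = 2` this says that
`2` is inert in `K`. -/
def TwoStaysPrimeIn (K : Type*) [Field K] [NumberField K] : Prop :=
  (Ideal.span {(2 : 𝓞 K)}).IsPrime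

/-! The discriminant of `L` is `|d_K| ^ n` times the norm of the different of `L / K`. As the
different is supported above `2`, the task is to bound its exponent at a prime `w` above `2` against
`T = w(2)`. For a uniformizer `x` this exponent is at most the sum of `w(x - g x)` over the
nontrivial elements `g` of the inertia group (`le_sum_log_of_pow_dvd_differentIdeal`).

A `2`-element of `GL₂` in characteristic two is an involution, so a Sylow `2`-subgroup `P` of
inertia is elementary abelian, of order `N = 2 ^ m`. It contains wild inertia, hence each of the `(e
- 1) N` elements of inertia outside `P` contributes at most `1`. On `P` one averages over quadratic
characters (`sum_log_le_of_exponent_two`). If `g b = χ(g) b`, then `2b = b - (-b)` is divisible by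
the product of the `x - g x` with `χ(g) = -1`. After scaling by invariants, `w(b)` is `0` or `N /
2`, the latter for at most half of the characters. This gives `2 N S ≤ 4 (N - 1) T + N ^ 2` for the
sum `S` over `P`.

If `2` is inert, `T = e N` and the bound follows. If `2` ramifies, `T = 2 e N` and one also needs `e
= 1`: the residue field is `𝔽₂`, so Frobenius conjugates tame inertia to its square, and inside
`GL₂` nontrivial wild inertia then forces every element of inertia to be an involution
(`mul_self_eq_one_of_conj_eq_mul_self`). -/

open Polynomial in
theorem Polynomial.prod_X_sub_C_dvd_of_eval_eq_zero {R ι : Type*} [CommRing R] [IsDomain R]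
    (p : R[X]) (s : Finset ι) (r : ι → R) (hr : Set.InjOn r s) (h : ∀ i ∈ s, p.eval (r i) = 0) :
    ∏ i ∈ s, (X - C (r i)) ∣ p := by
  rcases eq_or_ne p 0 with rfl | hp
  · exact dvd_zero _
  have key := (Multiset.prod_X_sub_C_dvd_iff_le_roots hp (s.val.map r)).2 <| by
    rw [Multiset.le_iff_subset]
    · intro y hy
      obtain ⟨i, hi, rfl⟩ := Multiset.mem_map.1 hy
      exact (mem_roots hp).2 (h i hi)
    · exact Multiset.Nodup.map_on (fun a ha b hb hab => hr ha hb hab) s.nodup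
  rw [Multiset.map_map] at key
  exact key

/-! ### Totally ramified actions on discretely valued fields -/

open WithZero IsDedekindDomain

/-- A finite group acting on a discretely valued field through isometries, such that the value
group of the field of invariants has index divisible by the order of the group; `x` is a
uniformizer. -/
structure IsTotallyRamifiedAction {L : Type*} [Field L] (v : Valuation L ℤᵐ⁰)
    (G : Type*) [Group G] [MulSemiringAction G L] (x : L) : Prop where
  map_smul : ∀ (g : G) (z : L), v (g • z) = v z
  fixed : ∀ z : L, (∀ g : G, g • z = z) → z ≠ 0 → ∃ k : ℤ, v z = exp (k * Nat.card G)
  uniformizer : v x = exp (-1)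

namespace IsTotallyRamifiedAction

variable {L : Type*} [Field L] {v : Valuation L ℤᵐ⁰} {G : Type*} [Group G]
  [MulSemiringAction G L] {x : L}

/-- Nonzero invariants have exponents divisible by the group order, so the nonzero terms have
exponents in distinct residue classes and cannot cancel. -/
theorem term_le_sum (h : IsTotallyRamifiedAction v G x) (c : Fin (Nat.card G) → L)
    (hc : ∀ i (g : G), g • c i = c i) (i : Fin (Nat.card G)) :
    v (c i * x ^ (i : ℕ)) ≤ v (∑ j, c j * x ^ (j : ℕ)) := by
  classical
  obtain ⟨j, -, hj⟩ := Finset.exists_max_image Finset.univ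
    (fun j : Fin (Nat.card G) => v (c j * x ^ (j : ℕ))) ⟨i, Finset.mem_univ i⟩
  rcases eq_or_ne (v (c j * x ^ (j : ℕ))) 0 with h0 | h0
  · exact ((hj i (Finset.mem_univ i)).trans h0.le).trans zero_le
  rw [Valuation.map_sum_eq_of_lt v (j := j) (Finset.mem_univ j)]
  · exact hj i (Finset.mem_univ i)
  intro k hk
  have hkj : k ≠ j := by simpa using hk
  refine lt_of_le_of_ne (hj k (Finset.mem_univ k)) fun heq => hkj ?_
  have hcj : c j ≠ 0 := by rintro h'; simp [h'] at h0
  have hck : c k ≠ 0 := by rintro h'; rw [← heq] at h0; simp [h'] at h0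
  obtain ⟨a, ha⟩ := h.fixed _ (hc j) hcj
  obtain ⟨b, hb⟩ := h.fixed _ (hc k) hck
  simp only [map_mul, map_pow, h.uniformizer, ha, hb, ← exp_nsmul, ← exp_add, exp_inj] at heq
  have h1 := k.2
  have h2 := j.2
  have h3 : (Nat.card G : ℤ) ∣ (k : ℕ) - (j : ℕ) := ⟨b - a, by
    simp only [nsmul_eq_mul] at heq; linarith⟩
  have h4 := Int.eq_zero_of_abs_lt_dvd h3 (by rw [abs_lt]; omega)
  exact Fin.ext (by omega)

variable [Finite G]

/-- By `term_le_sum` the powers of `x` are independent over the fixed field, and by Artin's theorem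
there are as many of them as its codegree. -/
theorem exists_eq_sum [FaithfulSMul G L] (h : IsTotallyRamifiedAction v G x) (y : L) :
    ∃ c : Fin (Nat.card G) → L, (∀ i (g : G), g • c i = c i) ∧ y = ∑ j, c j * x ^ (j : ℕ) := by
  have := Fintype.ofFinite G
  have hx0 : x ≠ 0 := by
    rintro rfl
    exact exp_ne_zero (h.uniformizer.symm.trans (map_zero v))
  have hli : LinearIndependent (FixedPoints.subfield G L)
      (fun i : Fin (Nat.card G) => x ^ (i : ℕ)) := by
    rw [Fintype.linearIndependent_iff]
    intro c hc i
    have := h.term_le_sum (fun i => (c i : L)) (fun i g => (c i).2 g) i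
    have hc' : ∑ j, (c j : L) * x ^ (j : ℕ) = 0 := hc
    rw [hc', map_zero, le_zero_iff, map_eq_zero] at this
    simpa [hx0] using this
  have hspan := hli.span_eq_top_of_card_eq_finrank' (by
    rw [FixedPoints.finrank_eq_card G L, Fintype.card_fin, Nat.card_eq_fintype_card])
  obtain ⟨c, hc⟩ := (Submodule.mem_span_range_iff_exists_fun _).1
    (hspan ▸ Submodule.mem_top : y ∈ Submodule.span (FixedPoints.subfield G L) (Set.range _))
  exact ⟨fun i => c i, fun i g => (c i).2 g, hc.symm⟩

theorem smul_ne_self [FaithfulSMul G L] (h : IsTotallyRamifiedAction v G x) {g : G} (hg : g ≠ 1) :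
    g • x ≠ x := by
  intro hx
  refine hg (FaithfulSMul.eq_of_smul_eq_smul (α := L) fun y => ?_)
  obtain ⟨c, hc, rfl⟩ := h.exists_eq_sum y
  simp [Finset.smul_sum, smul_mul', hc, smul_pow', hx]

theorem smul_uniformizer_injective [FaithfulSMul G L] (h : IsTotallyRamifiedAction v G x) :
    Function.Injective fun g : G => g • x := by
  intro g g' hgg
  by_contra hne
  refine h.smul_ne_self (g := g'⁻¹ * g) (fun h1 => hne ?_) ?_
  · exact (inv_mul_eq_one.1 h1).symm
  · rw [mul_smul, inv_smul_eq_iff]; exact hgg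

/-- Each term is integral by `term_le_sum`. If `c i` has value `exp (a * N)`, then `a * N ≤ i < N`,
which forces `a ≤ 0`. -/
theorem exists_integral_eq_sum [FaithfulSMul G L] (h : IsTotallyRamifiedAction v G x) {y : L}
    (hy : v y ≤ 1) : ∃ c : Fin (Nat.card G) → L, (∀ i (g : G), g • c i = c i) ∧
      (∀ i, v (c i) ≤ 1) ∧ y = ∑ j, c j * x ^ (j : ℕ) := by
  obtain ⟨c, hc, rfl⟩ := h.exists_eq_sum y
  refine ⟨c, hc, fun i => ?_, rfl⟩
  rcases eq_or_ne (c i) 0 with h0 | h0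
  · simp [h0]
  obtain ⟨a, ha⟩ := h.fixed _ (hc i) h0
  have := (h.term_le_sum c hc i).trans hy
  rw [map_mul, map_pow, h.uniformizer, ha, ← exp_nsmul, ← exp_add, ← exp_zero, exp_le_exp] at this
  rw [ha, ← exp_zero, exp_le_exp]
  have hi := i.2
  simp only [nsmul_eq_mul, mul_neg, mul_one] at this
  by_contra hlt
  have ha1 : 1 ≤ a := by
    by_contra hh
    exact hlt (mul_nonpos_of_nonpos_of_nonneg (by omega) (by positivity))
  nlinarith

/-- Elements of `G` mapping `y` to `z` contribute to the valuation of `z - y`. -/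
theorem map_sub_le_prod [FaithfulSMul G L] (h : IsTotallyRamifiedAction v G x) {y z : L}
    (hy : v y ≤ 1) (s : Finset G) (hs : ∀ g ∈ s, g • y = z) (hz : v z ≤ 1) :
    v (y - z) ≤ ∏ g ∈ s, v (x - g • x) := by
  obtain ⟨c, hc, hc1, hyc⟩ := h.exists_integral_eq_sum hy
  have hx1 : v x ≤ 1 := by
    rw [h.uniformizer, ← exp_zero, exp_le_exp]; omega
  let V := v.integer
  let X' : V := ⟨x, hx1⟩
  let r : G → V := fun g => ⟨g • x, (h.map_smul g x).le.trans hx1⟩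
  let p : Polynomial V := ∑ j : Fin (Nat.card G), Polynomial.C (⟨c j, hc1 j⟩ : V) * Polynomial.X ^ (j : ℕ)
  have hp : ∀ w : V, ((p.eval w : V) : L) = ∑ j, c j * (w : L) ^ (j : ℕ) := by
    intro w
    simp [p, Polynomial.eval_finsetSum]
  -- Since the coefficients are invariant, `p (g • x) = g • y = z` for `g ∈ s`. The conjugates `g •
  -- x` are distinct roots of `p - z`, and evaluating the resulting factorization at `x` gives the
  -- claim.
  have hdvd := Polynomial.prod_X_sub_C_dvd_of_eval_eq_zero (p - Polynomial.C (⟨z, hz⟩ : V)) s r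
    (fun a _ b _ hab => h.smul_uniformizer_injective (congrArg Subtype.val hab)) (by
      intro g hg
      apply Subtype.ext
      have : ((p.eval (r g) : V) : L) = z := by
        rw [hp, ← hs g hg, hyc, Finset.smul_sum]
        simp [r, smul_mul', hc, smul_pow']
      simp [this])
  obtain ⟨q, hq⟩ := hdvd
  have heval := congrArg (fun P : Polynomial V => ((P.eval X' : V) : L)) hq
  have h1 : ((p.eval X' : V) : L) = y := by rw [hp, hyc]
  simp only [Polynomial.eval_sub, Polynomial.eval_C, Polynomial.eval_mul, Polynomial.eval_prod,
    Polynomial.eval_X, Subring.coe_mul] at heval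
  rw [AddSubgroupClass.coe_sub, h1] at heval
  rw [heval, map_mul]
  have : ((∏ j ∈ s, (X' - r j) : V) : L) = ∏ g ∈ s, (x - g • x) := by
    push_cast
    rfl
  rw [this, map_prod]
  exact mul_le_of_le_one_right' (q.eval X').2

end IsTotallyRamifiedAction

/-! ### Quadratic characters and their eigenvectors -/

theorem WithZero.log_prod {ι : Type*} {s : Finset ι} {f : ι → ℤᵐ⁰} (hf : ∀ i ∈ s, f i ≠ 0) :
    log (∏ i ∈ s, f i) = ∑ i ∈ s, log (f i) := by
  classical
  induction s using Finset.induction_on with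
  | empty => simp
  | insert a s ha ih =>
    rw [Finset.prod_insert ha, Finset.sum_insert ha, log_mul, ih]
    · exact fun i hi => hf i (Finset.mem_insert_of_mem hi)
    · exact hf a (Finset.mem_insert_self _ _)
    · exact Finset.prod_ne_zero_iff.2 fun i hi => hf i (Finset.mem_insert_of_mem hi)

/-- The twisted trace `∑ χ(g) g z` is an eigenvector, and Dedekind's independence of automorphisms
provides a `z` for which it is nonzero. -/
theorem exists_quadratic_eigenvector {L G : Type*} [Field L] [Group G] [Finite G]
    [MulSemiringAction G L] [FaithfulSMul G L] (χ : G →* ℤˣ) :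
    ∃ b : L, b ≠ 0 ∧ ∀ g : G, g • b = ((χ g : ℤ) : L) * b := by
  have := Fintype.ofFinite G
  have hinj : Function.Injective fun g : G => ((MulSemiringAction.toRingHom G L g : L →+* L) : L →* L) := by
    intro g g' hgg
    exact FaithfulSMul.eq_of_smul_eq_smul (α := L) fun y => DFunLike.congr_fun hgg y
  have hli := (linearIndependent_monoidHom L L).comp _ hinj
  rw [Fintype.linearIndependent_iff] at hli
  have hz : ∃ z : L, ∑ g : G, ((χ g : ℤ) : L) * (g • z) ≠ 0 := by
    by_contra! hall
    have := hli (fun g => ((χ g : ℤ) : L)) (by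
      ext z
      simpa using hall z) 1
    simp at this
  obtain ⟨z, hz⟩ := hz
  refine ⟨_, hz, fun g => ?_⟩
  have hχ : ∀ g : G, ((χ g : ℤ) : L) * ((χ g : ℤ) : L) = 1 := fun g => by
    rw [← Int.cast_mul, ← Units.val_mul, Int.units_mul_self]; simp
  have hint : ∀ (k : ℤ) (w : L), g • ((k : L) * w) = (k : L) * g • w := fun k w => by
    rw [smul_mul', ← MulSemiringAction.toRingHom_apply (M := G) (R := L) g (k : L), map_intCast]
  rw [Finset.smul_sum, Finset.mul_sum]
  refine Fintype.sum_equiv (Equiv.mulLeft g) _ _ fun a => ?_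
  rw [hint, Equiv.coe_mulLeft, map_mul, mul_smul, Units.val_mul, Int.cast_mul, ← mul_assoc, ← mul_assoc, hχ, one_mul]

/-- Duality for finite groups of exponent dividing two. -/
theorem natCard_monoidHom_intUnits {G : Type*} [Group G] [Finite G] (hG : ∀ g : G, g * g = 1) :
    Nat.card (G →* ℤˣ) = Nat.card G ∧ ∀ g : G, g ≠ 1 → ∃ χ : G →* ℤˣ, χ g = -1 := by
  let : CommGroup G := { (inferInstance : Group G) with
    mul_comm := fun a b => by
      have h1 : ∀ a : G, a⁻¹ = a := fun a => inv_eq_of_mul_eq_one_left (hG a)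
      rw [← h1 (a * b), mul_inv_rev, h1, h1] }
  have h2 : HasEnoughRootsOfUnity ℤ 2 :=
    ⟨⟨-1, IsPrimitiveRoot.neg_one 0 (by norm_num)⟩, rootsOfUnity.isCyclic _ _⟩
  have hdvd : Monoid.exponent G ∣ 2 := Monoid.exponent_dvd_of_forall_pow_eq_one fun g => by
    rw [pow_two, hG]
  have h3 : HasEnoughRootsOfUnity ℤ (Monoid.exponent G) := HasEnoughRootsOfUnity.of_dvd ℤ hdvd
  refine ⟨CommGroup.card_monoidHom_of_hasEnoughRootsOfUnity G ℤ, fun g hg => ?_⟩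
  obtain ⟨χ, hχ⟩ := CommGroup.exists_apply_ne_one_of_hasEnoughRootsOfUnity G ℤ hg
  exact ⟨χ, (Int.units_eq_one_or _).resolve_left hχ⟩

/-- If the product of any two elements outside `p` lies in `p`, then at most half of the
elements lie outside `p`. -/
theorem two_mul_card_filter_not_le {X : Type*} [CommGroup X] [Fintype X] (p : X → Prop)
    [DecidablePred p] (hp : ∀ a b, ¬ p a → ¬ p b → p (a * b)) :
    2 * (Finset.univ.filter fun a => ¬ p a).card ≤ Fintype.card X := by
  have hsplit : (Finset.univ.filter fun a => p a).card + (Finset.univ.filter fun a => ¬ p a).card =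
      Fintype.card X := by
    rw [← Finset.card_univ]
    exact Finset.card_filter_add_card_filter_not _
  suffices (Finset.univ.filter fun a => ¬ p a).card ≤ (Finset.univ.filter fun a => p a).card by
    omega
  rcases (Finset.univ.filter fun a => ¬ p a).eq_empty_or_nonempty with h | ⟨a, ha⟩
  · simp [h]
  refine Finset.card_le_card_of_injOn (a * ·) (fun b hb => ?_) fun b _ c _ hbc => mul_left_cancel hbc
  simp only [Finset.coe_filter, Finset.mem_univ, true_and, Finset.mem_filter, Set.mem_ofPred_eq] at *
  exact hp a b ha hb

/-! ### Ramification numbers of elementary abelian `2`-groups -/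

namespace IsTotallyRamifiedAction

variable {L : Type*} [Field L] {v : Valuation L ℤᵐ⁰} {G : Type*} [Group G]
  [MulSemiringAction G L] {x : L}

theorem exists_fixed_uniformizer [Finite G] (h : IsTotallyRamifiedAction v G x) :
    ∃ π : L, (∀ g : G, g • π = π) ∧ v π = exp (-(Nat.card G : ℤ)) := by
  have := Fintype.ofFinite G
  refine ⟨∏ g : G, g • x, fun g => ?_, ?_⟩
  · rw [Finset.smul_prod']
    exact Fintype.prod_equiv (Equiv.mulLeft g) _ _ fun a => by simp [mul_smul]
  · rw [map_prod]
    simp only [h.map_smul, h.uniformizer, Finset.prod_const, Finset.card_univ, ← exp_nsmul,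
      Nat.card_eq_fintype_card]
    simp

/-- The character `χ` is cut out by an eigenvector whose square has even valuation in the field of
invariants. -/
def IsEvenCharacter (v : Valuation L ℤᵐ⁰) (χ : G →* ℤˣ) : Prop :=
  ∃ b : L, (∀ g : G, g • b = ((χ g : ℤ) : L) * b) ∧ ∃ j : ℤ, v b = exp (j * Nat.card G)

/-- The square of an eigenvector is invariant. -/
theorem exists_val_eigenvector (h : IsTotallyRamifiedAction v G x) {χ : G →* ℤˣ} {b : L}
    (hb0 : b ≠ 0) (hb : ∀ g : G, g • b = ((χ g : ℤ) : L) * b) :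
    ∃ t k : ℤ, v b = exp t ∧ 2 * t = k * Nat.card G := by
  obtain ⟨k, hk⟩ := h.fixed (b * b) (fun g => by
    have : ((χ g : ℤ) : L) * ((χ g : ℤ) : L) = 1 := by
      rw [← Int.cast_mul, ← Units.val_mul, Int.units_mul_self]; simp
    rw [smul_mul', hb]
    linear_combination b * b * this) (mul_ne_zero hb0 hb0)
  have hv : v b ≠ 0 := by simpa using hb0
  refine ⟨log (v b), k, (exp_log hv).symm, ?_⟩
  have := congrArg log hk
  rw [map_mul, log_mul hv hv, log_exp] at this
  linarith

variable [Finite G] [FaithfulSMul G L]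

/-- Eigenvectors of non-even characters have exponents that are odd multiples of half the group
order; two of these add up to a multiple of the full order. -/
theorem isEvenCharacter_mul (h : IsTotallyRamifiedAction v G x) {χ χ' : G →* ℤˣ}
    (hχ : ¬ IsEvenCharacter v χ) (hχ' : ¬ IsEvenCharacter v χ') : IsEvenCharacter v (χ * χ') := by
  obtain ⟨b, hb0, hb⟩ := exists_quadratic_eigenvector (L := L) χ
  obtain ⟨b', hb0', hb'⟩ := exists_quadratic_eigenvector (L := L) χ'
  obtain ⟨t, k, ht, hk⟩ := h.exists_val_eigenvector hb0 hb
  obtain ⟨t', k', ht', hk'⟩ := h.exists_val_eigenvector hb0' hb'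
  have odd_of : ∀ {χ : G →* ℤˣ} {b : L} {t k : ℤ}, (∀ g : G, g • b = ((χ g : ℤ) : L) * b) →
      v b = exp t → 2 * t = k * Nat.card G → ¬ IsEvenCharacter v χ → Odd k := by
    intro χ b t k hb ht hk hχ
    by_contra hev
    obtain ⟨j, rfl⟩ := Int.not_odd_iff_even.1 hev
    refine hχ ⟨b, hb, j, ?_⟩
    rw [ht]; congr 1; linarith
  obtain ⟨j, hj⟩ := (odd_of hb ht hk hχ).add_odd (odd_of hb' ht' hk' hχ')
  refine ⟨b * b', fun g => ?_, j, ?_⟩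
  · rw [smul_mul', hb, hb', MonoidHom.mul_apply, Units.val_mul, Int.cast_mul]; ring
  · rw [map_mul, ht, ht', ← exp_add]; congr 1
    have : (k + k') * (Nat.card G : ℤ) = (j + j) * Nat.card G := by rw [hj]
    linarith

open Classical in
/-- Bound for the ramification outside the kernel of a quadratic character. -/
theorem two_mul_sum_log_le [Fintype G] (h : IsTotallyRamifiedAction v G x) {T : ℤ}
    (hT : v 2 = exp (-T)) (χ : G →* ℤˣ) :
    2 * ∑ g with χ g = -1, -log (v (x - g • x)) ≤
      2 * T + if IsEvenCharacter v χ then 0 else (Nat.card G : ℤ) := by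
  -- Powers of an invariant uniformizer move `t` by multiples of the group order `N`, so `t` can be
  -- normalized to `0` or `-N / 2`.
  have key : ∃ b : L, (∀ g : G, g • b = ((χ g : ℤ) : L) * b) ∧ ∃ t : ℤ, v b = exp t ∧ t ≤ 0 ∧
      -(2 * t) ≤ if IsEvenCharacter v χ then 0 else (Nat.card G : ℤ) := by
    obtain ⟨π, hπ, hvπ⟩ := h.exists_fixed_uniformizer
    have hπj : ∀ (j : ℤ) (g : G), g • π ^ j = π ^ j := fun j g => by
      rw [← MulSemiringAction.toRingHom_apply, map_zpow₀, MulSemiringAction.toRingHom_apply, hπ]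
    have hvj : ∀ j : ℤ, v (π ^ j) = exp (-(j * Nat.card G)) := fun j => by
      rw [map_zpow₀, hvπ, ← exp_zsmul]; simp
    split_ifs with hev
    · obtain ⟨b, hb, j, hj⟩ := hev
      refine ⟨b * π ^ j, fun g => by rw [smul_mul', hb, hπj, mul_assoc], 0, ?_, le_rfl, by simp⟩
      rw [map_mul, hvj, hj, ← exp_add]; simp
    · obtain ⟨b, hb0, hb⟩ := exists_quadratic_eigenvector (L := L) χ
      obtain ⟨t, k, ht, hk⟩ := h.exists_val_eigenvector hb0 hb
      have hN : (0 : ℤ) < Nat.card G := by exact_mod_cast Nat.card_pos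
      obtain ⟨j, hj⟩ | ⟨j, hj⟩ := Int.even_or_odd k
      · refine ⟨b * π ^ j, fun g => by rw [smul_mul', hb, hπj, mul_assoc], 0, ?_, le_rfl, by simp⟩
        rw [map_mul, hvj, ht, ← exp_add]; congr 1
        rw [hj] at hk
        linarith
      · rw [hj] at hk
        refine ⟨b * π ^ (j + 1), fun g => by rw [smul_mul', hb, hπj, mul_assoc],
          t - (j + 1) * Nat.card G, ?_, ?_, ?_⟩
        · rw [map_mul, hvj, ht, ← exp_add, sub_eq_add_neg]
        · linarith
        · linarith
  obtain ⟨b, hb, t, ht, ht0, hle⟩ := key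
  have hvb : v b ≤ 1 := by rw [ht, ← exp_zero, exp_le_exp]; exact ht0
  have hmain := h.map_sub_le_prod (y := b) (z := -b) hvb (Finset.univ.filter fun g => χ g = -1)
    (fun g hg => by rw [hb, (Finset.mem_filter.1 hg).2]; simp) (by rwa [Valuation.map_neg])
  have h2b : v (b - -b) = exp (-T + t) := by
    rw [sub_neg_eq_add, ← two_mul, map_mul, hT, ht, exp_add]
  have hne : ∀ g ∈ Finset.univ.filter (fun g : G => χ g = -1), v (x - g • x) ≠ 0 := by
    intro g hg
    have hg1 : g ≠ 1 := by
      rintro rfl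
      simp at hg
    rw [map_ne_zero]
    exact sub_ne_zero.2 (h.smul_ne_self hg1).symm
  rw [h2b] at hmain
  have := le_log_of_exp_le hmain
  rw [log_prod hne] at this
  rw [Finset.sum_neg_distrib]
  linarith

/-- The different exponent of a totally ramified elementary abelian `2`-extension. -/
theorem sum_log_le_of_exponent_two [Fintype G] [DecidableEq G] (h : IsTotallyRamifiedAction v G x)
    (hG : ∀ g : G, g * g = 1) {T : ℤ} (hT : v 2 = exp (-T)) :
    2 * Nat.card G * ∑ g ∈ Finset.univ.erase (1 : G), -log (v (x - g • x)) ≤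
      4 * (Nat.card G - 1) * T + Nat.card G ^ 2 := by
  classical
  obtain ⟨hcard, hsep⟩ := natCard_monoidHom_intUnits hG
  have : Finite (G →* ℤˣ) := Nat.finite_of_card_ne_zero (by rw [hcard]; exact Nat.card_pos.ne')
  have := Fintype.ofFinite (G →* ℤˣ)
  set N := Nat.card G with hN
  have hcard' : Fintype.card (G →* ℤˣ) = N := by rw [← Nat.card_eq_fintype_card, hcard]
  -- Multiplication by a character `χ₀` with `χ₀ g = -1` exchanges the two values at `g`.
  have hhalf : ∀ g : G, g ≠ 1 →
      2 * (Finset.univ.filter fun χ : G →* ℤˣ => χ g = -1).card = N := by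
    intro g hg
    obtain ⟨χ₀, hχ₀⟩ := hsep g hg
    have h1 := Finset.card_filter_add_card_filter_not
      (s := (Finset.univ : Finset (G →* ℤˣ))) (fun χ => χ g = -1)
    rw [Finset.card_univ, hcard'] at h1
    have h2 : (Finset.univ.filter fun χ : G →* ℤˣ => χ g = -1).card =
        (Finset.univ.filter fun χ : G →* ℤˣ => ¬ χ g = -1).card := by
      refine Finset.card_equiv (Equiv.mulLeft χ₀) fun χ => ?_
      simp only [Finset.mem_filter, Finset.mem_univ, true_and, Equiv.coe_mulLeft,
        MonoidHom.mul_apply, hχ₀]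
      rcases Int.units_eq_one_or (χ g) with h' | h' <;> rw [h'] <;> decide
    omega
  have hdouble : 2 * ∑ χ : G →* ℤˣ, ∑ g with χ g = -1, -log (v (x - g • x)) =
      N * ∑ g ∈ Finset.univ.erase (1 : G), -log (v (x - g • x)) := by
    simp only [Finset.sum_filter]
    rw [Finset.sum_comm, Finset.mul_sum, Finset.mul_sum,
      ← Finset.add_sum_erase _ _ (Finset.mem_univ (1 : G))]
    have h1 : (if (1 : ℤˣ) = -1 then -log (v (x - (1 : G) • x)) else 0) = 0 := by simp
    simp only [map_one, h1, Finset.sum_const_zero, mul_zero, zero_add]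
    refine Finset.sum_congr rfl fun g hg => ?_
    rw [← Finset.sum_filter, Finset.sum_const, nsmul_eq_mul, ← mul_assoc,
      ← hhalf g (Finset.ne_of_mem_erase hg)]
    push_cast
    ring
  have hodd : 2 * ((Finset.univ.filter fun χ : G →* ℤˣ => ¬ IsEvenCharacter v χ).card : ℤ) ≤ N := by
    exact_mod_cast hcard' ▸ two_mul_card_filter_not_le (X := G →* ℤˣ) (IsEvenCharacter v)
      fun a b ha hb => h.isEvenCharacter_mul ha hb
  have hupper : ∑ χ : G →* ℤˣ, 2 * ∑ g with χ g = -1, -log (v (x - g • x)) ≤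
      2 * ((N : ℤ) - 1) * T +
        N * (Finset.univ.filter fun χ : G →* ℤˣ => ¬ IsEvenCharacter v χ).card := by
    -- The trivial character contributes nothing; this turns the factor `N` of `T` into `N - 1`.
    have hone : ∑ g with (1 : G →* ℤˣ) g = -1, -log (v (x - g • x)) = 0 := by simp
    rw [← Finset.add_sum_erase _ _ (Finset.mem_univ (1 : G →* ℤˣ)), hone, mul_zero, zero_add]
    refine (Finset.sum_le_sum fun χ _ => h.two_mul_sum_log_le hT χ).trans ?_
    rw [Finset.sum_add_distrib, Finset.sum_const, Finset.card_erase_of_mem (Finset.mem_univ _),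
      Finset.card_univ, hcard', nsmul_eq_mul, Nat.cast_sub (by rw [hN]; exact Nat.card_pos)]
    refine add_le_add (le_of_eq (by push_cast; ring)) ?_
    refine (Finset.sum_le_sum_of_subset_of_nonneg (Finset.erase_subset _ _) ?_).trans ?_
    · intro χ _ _; split_ifs <;> positivity
    · rw [Finset.card_filter, Nat.cast_sum, Finset.mul_sum]
      refine Finset.sum_le_sum fun χ _ => ?_
      split_ifs <;> simp [hN]
  rw [← Finset.mul_sum, hdouble] at hupper
  have hN0 : (0 : ℤ) ≤ N := by positivity
  nlinarith [mul_le_mul_of_nonneg_left hodd hN0]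

end IsTotallyRamifiedAction

/-! ### The different and the inertia group -/

/-- The different contains the derivative of the characteristic polynomial of a generator. -/
theorem prod_sub_smul_mem_differentIdeal (A K L : Type*) {B : Type*} [CommRing A] [Field K]
    [CommRing B] [Field L] [Algebra A K] [Algebra B L] [Algebra A B] [Algebra K L] [Algebra A L]
    [IsScalarTower A K L] [IsScalarTower A B L] [IsFractionRing A K]
    [FiniteDimensional K L] [Algebra.IsSeparable K L] [IsIntegralClosure B A L]
    [IsDedekindDomain B] [IsFractionRing B L] [IsDedekindDomain A]
    [Module.IsTorsionFree A B]
    (G : Type*) [Group G] [Fintype G] [DecidableEq G] [MulSemiringAction G B]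
    [IsGaloisGroup G A B] (x : B) (hx : Algebra.adjoin K {algebraMap B L x} = ⊤) :
    ∏ g ∈ Finset.univ.erase (1 : G), (x - g • x) ∈ differentIdeal A B := by
  obtain ⟨P, hP⟩ := Algebra.IsInvariant.charpoly_mem_lifts A B G x
  have hP' : P.map (algebraMap A B) = MulSemiringAction.charpoly G x := hP
  have hdiff := aeval_derivative_mem_differentIdeal A K L x hx
  -- As `x` is a root of both polynomials, `P'(x)` is a multiple of the derivative of the minimal
  -- polynomial at `x`.
  obtain ⟨R, hR⟩ : minpoly A x ∣ P := by
    refine minpoly.isIntegrallyClosed_dvd (IsIntegralClosure.isIntegral A L x) ?_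
    rw [Polynomial.aeval_def, ← Polynomial.eval_map, hP', MulSemiringAction.eval_charpoly]
  have hmem : Polynomial.aeval x (Polynomial.derivative P) ∈ differentIdeal A B := by
    rw [hR, Polynomial.derivative_mul, map_add, map_mul, map_mul, minpoly.aeval, zero_mul, add_zero]
    exact Ideal.mul_mem_right _ _ hdiff
  have hder : Polynomial.aeval x (Polynomial.derivative P) =
      ∏ g ∈ Finset.univ.erase (1 : G), (x - g • x) := by
    rw [Polynomial.aeval_def, ← Polynomial.eval_map, ← Polynomial.derivative_map, hP',
      MulSemiringAction.charpoly_eq, ← Finset.mul_prod_erase _ _ (Finset.mem_univ (1 : G)),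
      Polynomial.derivative_mul]
    simp [Polynomial.eval_prod]
  rwa [← hder]

section

variable {K L : Type*} [Field K] [Field L] [NumberField L] [Algebra K L]

/-- The valuation attached to a prime is invariant under its inertia group. -/
theorem valuation_smul_of_mem_inertia (w : HeightOneSpectrum (𝓞 L)) {σ : Gal(L/K)}
    (hσ : σ ∈ w.asIdeal.inertia Gal(L/K)) (z : L) : w.valuation L (σ • z) = w.valuation L z := by
  open scoped Pointwise in
  have hst : ∀ {τ : Gal(L/K)}, τ ∈ w.asIdeal.inertia Gal(L/K) → ∀ r : 𝓞 L, ∀ n : ℕ,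
      r ∈ w.asIdeal ^ n → τ • r ∈ w.asIdeal ^ n := by
    intro τ hτ r n hr
    have hs : τ • w.asIdeal = w.asIdeal := Ideal.inertia_le_stabilizer w.asIdeal hτ
    have := Ideal.smul_mem_pointwise_smul τ r _ hr
    rwa [Ideal.pointwise_smul_def, Ideal.map_pow, ← Ideal.pointwise_smul_def, hs] at this
  have hle : ∀ {τ : Gal(L/K)}, τ ∈ w.asIdeal.inertia Gal(L/K) → ∀ r : 𝓞 L,
      w.intValuation (τ • r) ≤ w.intValuation r := by
    intro τ hτ r
    rcases eq_or_ne r 0 with rfl | hr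
    · simp
    rw [w.intValuation_eq_exp_neg_multiplicity hr, w.intValuation_le_pow_iff_mem]
    exact hst hτ r _ ((w.intValuation_le_pow_iff_mem r _).1
      (w.intValuation_eq_exp_neg_multiplicity hr).le)
  have heq : ∀ r : 𝓞 L, w.intValuation (σ • r) = w.intValuation r := fun r =>
    le_antisymm (hle hσ r) (by simpa using hle (inv_mem hσ) (σ • r))
  obtain ⟨a, b, hb, rfl⟩ := IsFractionRing.div_surjective (A := 𝓞 L) z
  rw [smul_div₀', ← algebraMap.smul', ← algebraMap.smul', map_div₀, map_div₀,
    w.valuation_of_algebraMap, w.valuation_of_algebraMap, w.valuation_of_algebraMap,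
    w.valuation_of_algebraMap, heq, heq]

variable [NumberField K] [IsGalois K L]

theorem isGaloisGroup_ringOfIntegers_fixedPoints (J : Subgroup Gal(L/K)) :
    IsGaloisGroup J (𝓞 (FixedPoints.intermediateField J : IntermediateField K L)) (𝓞 L) :=
  IsGaloisGroup.of_isFractionRing J _ _ (FixedPoints.intermediateField J : IntermediateField K L) L

theorem natCard_inertia_eq_ramificationIdx (Q : Ideal (𝓞 L)) [Q.IsPrime] :
    Nat.card (Q.inertia Gal(L/K)) = Q.ramificationIdx (𝓞 K) := by
  rw [Ideal.card_inertia_eq_ramificationIdxIn (Q.under (𝓞 K)) Q,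
    Ideal.ramificationIdxIn_eq_ramificationIdx (Q.under (𝓞 K)) Q Gal(L/K)]

/-- A subgroup of the inertia group is totally ramified. -/
theorem ramificationIdx_fixedPoints (Q : Ideal (𝓞 L)) [Q.IsPrime] (J : Subgroup Gal(L/K))
    (hJ : J ≤ Q.inertia Gal(L/K)) :
    Q.ramificationIdx (𝓞 (FixedPoints.intermediateField J : IntermediateField K L)) =
      Nat.card J := by
  have := isGaloisGroup_ringOfIntegers_fixedPoints J
  set F : IntermediateField K L := FixedPoints.intermediateField J
  have hin : Q.inertia J = ⊤ := by
    rw [eq_top_iff]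
    intro σ _
    exact Ideal.coe_mem_inertia.1 (hJ σ.2)
  rw [← Ideal.ramificationIdxIn_eq_ramificationIdx (Q.under (𝓞 F)) Q J,
    ← Ideal.card_inertia_eq_ramificationIdxIn (G := J) (Q.under (𝓞 F)) Q, hin]
  exact Nat.card_congr Subgroup.topEquiv.toEquiv

/-- The ramification index over the fixed field of `J` is the order of `J`, so values of invariants
are multiplied by that order when read in `L`. -/
theorem isTotallyRamifiedAction_of_le_inertia (w : HeightOneSpectrum (𝓞 L))
    (J : Subgroup Gal(L/K)) (hJ : J ≤ w.asIdeal.inertia Gal(L/K)) {x : L}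
    (hx : w.valuation L x = exp (-1)) :
    IsTotallyRamifiedAction (w.valuation L) J x where
  map_smul g z := valuation_smul_of_mem_inertia w (hJ g.2) z
  fixed z hz hz0 := by
    have hram := ramificationIdx_fixedPoints w.asIdeal J hJ
    set F : IntermediateField K L := FixedPoints.intermediateField J with hF
    have hne : w.asIdeal.under (𝓞 F) ≠ ⊥ := mt Ideal.eq_bot_of_comap_eq_bot w.ne_bot
    let u : HeightOneSpectrum (𝓞 F) := ⟨w.asIdeal.under (𝓞 F), inferInstance, hne⟩
    have : w.asIdeal.LiesOver u.asIdeal := ⟨rfl⟩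
    let z' : F := ⟨z, hz⟩
    have hz0' : z' ≠ 0 := fun h => hz0 (congrArg Subtype.val h)
    have hval := u.valuation_liesOver L w z'
    rw [Ideal.ramificationIdx'_eq_ramificationIdx _ _ hne, hram] at hval
    have h0 : u.valuation F z' ≠ 0 := by rwa [Valuation.ne_zero_iff]
    refine ⟨log (u.valuation F z'), ?_⟩
    change w.valuation L (algebraMap F L z') = _
    rw [← hval, ← exp_log h0, ← exp_nsmul, log_exp, nsmul_eq_mul, mul_comm]
  uniformizer := hx

/-- The exponent of a prime in the different is bounded by the ramification numbers of the inertia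
group. -/
theorem le_sum_log_of_pow_dvd_differentIdeal (w : HeightOneSpectrum (𝓞 L)) {x : 𝓞 L}
    (hx : w.valuation L x = exp (-1)) {k : ℕ} (hk : w.asIdeal ^ k ∣ differentIdeal (𝓞 K) (𝓞 L))
    {I : Subgroup Gal(L/K)} (hI : I = w.asIdeal.inertia Gal(L/K)) [Fintype I] [DecidableEq I] :
    (k : ℤ) ≤ ∑ g ∈ Finset.univ.erase (1 : I),
      -log (w.valuation L ((x : L) - g • (x : L))) := by
  have hact := isTotallyRamifiedAction_of_le_inertia w I hI.le hx
  have hram := ramificationIdx_fixedPoints w.asIdeal I hI.le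
  have hGal : IsGaloisGroup I (FixedPoints.intermediateField I : IntermediateField K L) L :=
    inferInstance
  set F : IntermediateField K L := FixedPoints.intermediateField I with hF
  -- All ramification occurs above the inertia field `F`, so by transitivity only the different of
  -- `L / F` matters at `w`.
  have hunr : (w.asIdeal.under (𝓞 F)).ramificationIdx (𝓞 K) = 1 := by
    have htower := Ideal.ramificationIdx_tower (R := 𝓞 K) (w.asIdeal.under (𝓞 F)) w.asIdeal
    rw [hram, ← natCard_inertia_eq_ramificationIdx, ← hI] at htower
    exact (right_eq_mul₀ Nat.card_pos.ne').1 htower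
  have hnot : ¬ w.asIdeal ∣ (differentIdeal (𝓞 K) (𝓞 F)).map (algebraMap (𝓞 F) (𝓞 L)) := by
    rw [Ideal.dvd_iff_le, Ideal.map_le_iff_le_comap]
    intro hle
    exact (not_dvd_differentIdeal_iff (A := 𝓞 K)).2 (Ideal.ramificationIdx_eq_one_iff.1 hunr)
      (Ideal.dvd_iff_le.2 hle)
  rw [differentIdeal_eq_differentIdeal_mul_differentIdeal (𝓞 K) (𝓞 F) (𝓞 L)] at hk
  have hdvd := w.prime.pow_dvd_of_dvd_mul_right k hnot hk
  -- The powers of a uniformizer span `L` over `F` because the action is totally ramified.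
  have htop : Algebra.adjoin F {algebraMap (𝓞 L) L x} = ⊤ := by
    rw [eq_top_iff]
    intro y _
    obtain ⟨c, hc, rfl⟩ := hact.exists_eq_sum y
    refine sum_mem fun j _ => mul_mem ?_
      (pow_mem (Algebra.self_mem_adjoin_singleton F (algebraMap (𝓞 L) L x)) _)
    exact Subalgebra.algebraMap_mem _ (⟨c j, hc j⟩ : F)
  have := isGaloisGroup_ringOfIntegers_fixedPoints I
  have hmem := prod_sub_smul_mem_differentIdeal (𝓞 F) F L I x htop
  have hcast : algebraMap (𝓞 L) L (∏ g ∈ Finset.univ.erase (1 : I), (x - g • x)) =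
      ∏ g ∈ Finset.univ.erase (1 : I), ((x : L) - g • (x : L)) := by
    rw [map_prod]
    rfl
  have hprod : w.valuation L (algebraMap (𝓞 L) L (∏ g ∈ Finset.univ.erase (1 : I), (x - g • x))) ≤
      exp (-(k : ℤ)) := by
    rw [w.valuation_of_algebraMap]
    exact (w.intValuation_le_pow_iff_mem _ k).2 (Ideal.dvd_iff_le.1 hdvd hmem)
  rw [hcast, map_prod] at hprod
  have hne : ∀ g ∈ Finset.univ.erase (1 : I), w.valuation L ((x : L) - g • (x : L)) ≠ 0 :=
    fun g hg => (map_ne_zero _).2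
      (sub_ne_zero.2 (hact.smul_ne_self (Finset.ne_of_mem_erase hg)).symm)
  have hlog := (log_le_iff_le_exp (Finset.prod_ne_zero_iff.2 hne)).2 hprod
  rw [log_prod hne] at hlog
  rw [Finset.sum_neg_distrib]
  linarith

end

/-! ### Wild inertia and the tame action on `Q / Q ^ 2` -/

namespace Ideal

section WildInertia

variable {B : Type*} [CommRing B] (Q : Ideal B) (G : Type*) [Group G] [MulSemiringAction G B]

/-- The wild inertia group: the elements of the inertia group acting trivially on `Q / Q ^ 2`. -/
def wildInertia : Subgroup G where
  carrier := {σ | σ ∈ Q.inertia G ∧ ∀ a ∈ Q, σ • a - a ∈ Q ^ 2}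
  one_mem' := ⟨one_mem _, by simp⟩
  mul_mem' := by
    rintro σ τ ⟨hσ, hσ2⟩ ⟨hτ, hτ2⟩
    refine ⟨mul_mem hσ hτ, fun a ha => ?_⟩
    have hτa : τ • a ∈ Q := by
      have := add_mem (hτ a) ha
      rwa [sub_add_cancel] at this
    have := add_mem (hσ2 _ hτa) (hτ2 a ha)
    rwa [sub_add_sub_cancel, ← mul_smul] at this
  inv_mem' := by
    rintro σ ⟨hσ, hσ2⟩
    refine ⟨inv_mem hσ, fun a ha => ?_⟩
    have hσa : σ⁻¹ • a ∈ Q := by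
      have := add_mem (inv_mem hσ a) ha
      rwa [sub_add_cancel] at this
    have := neg_mem (hσ2 _ hσa)
    rwa [smul_inv_smul, neg_sub] at this

variable {Q G}

theorem smul_mem_of_mem_inertia {σ : G} (hσ : σ ∈ Q.inertia G) {a : B} (ha : a ∈ Q) :
    σ • a ∈ Q := by
  have := add_mem (hσ a) ha
  rwa [sub_add_cancel] at this

theorem wildInertia_le_inertia : Q.wildInertia G ≤ Q.inertia G := fun _ h => h.1

/-- Triviality on `B / Q` and on `Q / Q ^ 2` passes to products by the Leibniz-type identity for `σ
• (b * c) - b * c`. -/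
theorem smul_sub_mem_pow_succ {σ : G} (hσ : σ ∈ Q.wildInertia G) (i : ℕ) {a : B}
    (ha : a ∈ Q ^ i) : σ • a - a ∈ Q ^ (i + 1) := by
  induction i generalizing a with
  | zero => simpa using hσ.1 a
  | succ i ih =>
    rw [pow_succ] at ha
    refine Submodule.mul_induction_on ha (fun b hb c hc => ?_) fun b c hb hc => ?_
    · have h1 : σ • (b * c) - b * c = (σ • b - b) * σ • c + b * (σ • c - c) := by
        rw [smul_mul']; ring
      rw [h1]
      refine add_mem ?_ ?_
      · rw [pow_succ (n := i + 1)]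
        exact mul_mem_mul (ih hb) (smul_mem_of_mem_inertia hσ.1 hc)
      · rw [add_assoc, pow_add]
        exact mul_mem_mul hb (hσ.2 c hc)
    · rw [smul_add, add_sub_add_comm]
      exact add_mem hb hc

/-- Elements of the wild inertia group whose order is prime to the residue characteristic are
trivial. -/
theorem eq_one_of_mem_wildInertia [FaithfulSMul G B] [IsDomain B] [IsNoetherianRing B]
    [hQ : Q.IsMaximal] {σ : G} (hσ : σ ∈ Q.wildInertia G) {r : ℕ} (hr : (r : B) ∉ Q)
    (hσr : σ ^ r = 1) : σ = 1 := by
  refine FaithfulSMul.eq_of_smul_eq_smul (α := B) fun a => ?_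
  rw [one_smul, ← sub_eq_zero]
  -- Krull's intersection theorem. In the induction, `σ` fixes `d = σ a - a` modulo `Q ^ (i + 1)`,
  -- so the telescoping sum `σ ^ r a - a = 0` is congruent to `r d`.
  suffices ∀ i, σ • a - a ∈ Q ^ i by
    have h1 : σ • a - a ∈ ⨅ i : ℕ, Q ^ i := by simpa [Submodule.mem_iInf] using this
    rwa [Q.iInf_pow_eq_bot_of_isDomain hQ.ne_top, Ideal.mem_bot] at h1
  intro i
  induction i with
  | zero => simp
  | succ i ih =>
    set d := σ • a - a with hd
    have htel : ∀ k : ℕ, ∑ j ∈ Finset.range k, σ ^ j • d = σ ^ k • a - a := by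
      intro k
      induction k with
      | zero => simp
      | succ k ihk =>
        rw [Finset.sum_range_succ, ihk, hd, smul_sub, ← mul_smul, ← pow_succ]
        ring
    have hsum : ∑ j ∈ Finset.range r, (σ ^ j • d - d) ∈ Q ^ (i + 1) :=
      Submodule.sum_mem _ fun j _ => smul_sub_mem_pow_succ (pow_mem hσ j) i ih
    rw [Finset.sum_sub_distrib, htel, hσr, one_smul, sub_self, zero_sub, Finset.sum_const,
      Finset.card_range, nsmul_eq_mul] at hsum
    exact (IsMaximal.mul_mem_pow Q (neg_mem_iff.1 hsum)).resolve_left hr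

/-- Raising an element to the `2`-part of its order leaves odd order, and odd integers lie outside
`Q`. -/
theorem isPGroup_wildInertia [Finite G] [FaithfulSMul G B] [IsDomain B] [IsNoetherianRing B]
    [hQ : Q.IsMaximal] (h2 : (2 : B) ∈ Q) : IsPGroup 2 (Q.wildInertia G) := by
  intro σ
  obtain ⟨k, r, hr, hkr⟩ := Nat.exists_eq_two_pow_mul_odd (orderOf_pos (σ : G)).ne'
  refine ⟨k, Subtype.ext ?_⟩
  refine eq_one_of_mem_wildInertia (pow_mem σ.2 (2 ^ k)) (r := r) (fun hrQ => ?_) ?_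
  · obtain ⟨s, rfl⟩ := hr
    refine hQ.ne_top ((Ideal.eq_top_iff_one _).2 ?_)
    have := sub_mem hrQ (Q.mul_mem_right (s : B) h2)
    push_cast at this
    rwa [add_sub_cancel_left] at this
  · rw [Subgroup.coe_pow, ← pow_mul, ← hkr, pow_orderOf_eq_one]

theorem smul_mem_sq_of_mem_inertia {σ : G} (hσ : σ ∈ Q.inertia G) {a : B} (ha : a ∈ Q ^ 2) :
    σ • a ∈ Q ^ 2 := by
  rw [pow_two] at ha ⊢
  refine Submodule.mul_induction_on ha (fun b hb c hc => ?_) fun b c hb hc => ?_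
  · rw [smul_mul']
    exact mul_mem_mul (smul_mem_of_mem_inertia hσ hb) (smul_mem_of_mem_inertia hσ hc)
  · rw [smul_add]
    exact add_mem hb hc

open scoped Pointwise in
theorem conj_mem_wildInertia {φ σ : G} (hφ : φ ∈ MulAction.stabilizer G Q)
    (hσ : σ ∈ Q.wildInertia G) : φ * σ * φ⁻¹ ∈ Q.wildInertia G := by
  have hmem : ∀ {ψ : G}, ψ ∈ MulAction.stabilizer G Q → ∀ (n : ℕ), ∀ a ∈ Q ^ n, ψ • a ∈ Q ^ n := by
    intro ψ hψ n a ha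
    have := Ideal.smul_mem_pointwise_smul ψ a _ ha
    rwa [Ideal.pointwise_smul_def, Ideal.map_pow, ← Ideal.pointwise_smul_def,
      MulAction.mem_stabilizer_iff.1 hψ] at this
  have hinv : ∀ a ∈ Q, φ⁻¹ • a ∈ Q := by simpa using hmem (inv_mem hφ) 1
  refine ⟨fun b => ?_, fun a ha => ?_⟩
  · have := hmem hφ 1 (σ • φ⁻¹ • b - φ⁻¹ • b) (by simpa using hσ.1 (φ⁻¹ • b))
    rw [pow_one, smul_sub, smul_inv_smul] at this
    rwa [mul_smul, mul_smul]
  · have := hmem hφ 2 _ (hσ.2 _ (hinv a ha))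
    rw [smul_sub, smul_inv_smul] at this
    rwa [mul_smul, mul_smul]

section Uniformizer

variable [IsDedekindDomain B] [Q.IsPrime] {x : B}

theorem exists_mem_notMem_sq (hQ : Q ≠ ⊥) : ∃ x ∈ Q, x ∉ Q ^ 2 := by
  have hlt := Ideal.pow_right_strictAnti Q hQ (Ideal.IsPrime.ne_top inferInstance)
    (show 1 < 2 by norm_num)
  obtain ⟨x, hx, hx2⟩ := SetLike.exists_of_lt hlt
  exact ⟨x, by simpa using hx, hx2⟩

theorem exists_mul_add_of_uniformizer (hQ : Q ≠ ⊥) (hx : x ∈ Q) (hx2 : x ∉ Q ^ 2) {a : B}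
    (ha : a ∈ Q) : ∃ b, ∃ q ∈ Q ^ 2, x * b + q = a :=
  Ideal.exists_mul_add_mem_pow_succ (i := 1) hQ x a (by simpa using hx) hx2 (by simpa using ha)

/-- Inertia acts on `Q / Q ^ 2` through scalars. -/
theorem exists_smul_sub_mul_mem_sq (hQ : Q ≠ ⊥) (hx : x ∈ Q) (hx2 : x ∉ Q ^ 2) {σ : G}
    (hσ : σ ∈ Q.inertia G) {c : B} (hc : σ • x - c * x ∈ Q ^ 2) {a : B} (ha : a ∈ Q) :
    σ • a - c * a ∈ Q ^ 2 := by
  obtain ⟨b, q, hq, rfl⟩ := exists_mul_add_of_uniformizer hQ hx hx2 ha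
  have h1 : σ • (x * b + q) - c * (x * b + q) =
      (σ • x - c * x) * b + (σ • x * (σ • b - b) + (σ • q - c * q)) := by
    rw [smul_add, smul_mul']; ring
  rw [h1]
  refine add_mem (Ideal.mul_mem_right _ _ hc) (add_mem ?_ (sub_mem ?_ (Ideal.mul_mem_left _ _ hq)))
  · rw [pow_two]
    exact mul_mem_mul (smul_mem_of_mem_inertia hσ hx) (hσ b)
  · exact smul_mem_sq_of_mem_inertia hσ hq

theorem exists_scalar_of_mem_inertia (hQ : Q ≠ ⊥) {σ : G} (hσ : σ ∈ Q.inertia G) :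
    ∃ c : B, ∀ a ∈ Q, σ • a - c * a ∈ Q ^ 2 := by
  obtain ⟨x, hx, hx2⟩ := exists_mem_notMem_sq hQ
  obtain ⟨c, q, hq, h⟩ := exists_mul_add_of_uniformizer hQ hx hx2 (smul_mem_of_mem_inertia hσ hx)
  refine ⟨c, fun a ha => exists_smul_sub_mul_mem_sq hQ hx hx2 hσ (c := c) ?_ ha⟩
  rw [← h, mul_comm, add_sub_cancel_left]
  exact hq

theorem mem_wildInertia_of_smul_sub_mem_sq (hQ : Q ≠ ⊥) (hx : x ∈ Q) (hx2 : x ∉ Q ^ 2) {σ : G}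
    (hσ : σ ∈ Q.inertia G) (h : σ • x - x ∈ Q ^ 2) : σ ∈ Q.wildInertia G := by
  refine ⟨hσ, fun a ha => ?_⟩
  simpa using exists_smul_sub_mul_mem_sq hQ hx hx2 hσ (c := 1) (by simpa using h) ha

/-- Involutions in the inertia group at a prime above `2` are wild. -/
theorem mem_wildInertia_of_sq_eq_one (hQ : Q ≠ ⊥) (h2 : (2 : B) ∈ Q) {σ : G}
    (hσ : σ ∈ Q.inertia G) (hσ2 : σ * σ = 1) : σ ∈ Q.wildInertia G := by
  obtain ⟨x, hx, hx2⟩ := exists_mem_notMem_sq hQ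
  obtain ⟨c, hc⟩ := exists_scalar_of_mem_inertia hQ hσ
  have h1 : (c * c - 1) * x ∈ Q ^ 2 := by
    have h3 := hc _ (smul_mem_of_mem_inertia hσ hx)
    rw [← mul_smul, hσ2, one_smul] at h3
    have := neg_mem (add_mem h3 (Ideal.mul_mem_left _ c (hc x hx)))
    convert this using 1
    ring
  have h3 : c * c - 1 ∈ Q := by
    by_contra hne
    exact hx2 ((Ideal.IsPrime.mul_mem_pow Q h1).resolve_left hne)
  -- Modulo `2` the element `c ^ 2 - 1` is the square of `c - 1`, so the scalar of an involution is
  -- `1` in the residue field.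
  have h4 : (c - 1) * (c - 1) ∈ Q := by
    have := sub_mem h3 (Q.mul_mem_right (c - 1) h2)
    convert this using 1
    ring
  have h5 : c - 1 ∈ Q := by simpa using Ideal.IsPrime.mem_or_mem ‹_› h4
  refine ⟨hσ, fun a ha => ?_⟩
  have := add_mem (hc a ha) (pow_two Q ▸ mul_mem_mul h5 ha : (c - 1) * a ∈ Q ^ 2)
  convert this using 1
  ring

open scoped Pointwise in
/-- A Frobenius element at a prime with residue field `𝔽₂` below conjugates tame inertia to its
square. -/
theorem frobenius_conj_mem_wildInertia {R : Type*} [CommRing R] [Algebra R B] [SMulCommClass G R B]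
    (hQ : Q ≠ ⊥) (hcard : Nat.card (R ⧸ Q.under R) = 2) {φ τ : G} (hφ : IsArithFrobAt R φ Q)
    (hτ : τ ∈ Q.inertia G) : φ * τ * φ⁻¹ * (τ * τ)⁻¹ ∈ Q.wildInertia G := by
  have hst := hφ.mem_stabilizer
  have hmem : ∀ {ψ : G}, ψ ∈ MulAction.stabilizer G Q → ∀ a ∈ Q, ψ • a ∈ Q := by
    intro ψ hψ a ha
    have := Ideal.smul_mem_pointwise_smul ψ a _ ha
    rwa [MulAction.mem_stabilizer_iff.1 hψ] at this
  have hmem2 : ∀ a ∈ Q ^ 2, φ • a ∈ Q ^ 2 := by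
    intro a ha
    have := Ideal.smul_mem_pointwise_smul φ a _ ha
    rwa [Ideal.pointwise_smul_def, Ideal.map_pow, ← Ideal.pointwise_smul_def,
      MulAction.mem_stabilizer_iff.1 hst] at this
  have hconj : φ * τ * φ⁻¹ ∈ Q.inertia G := by
    intro b
    have := hmem hst _ (hτ (φ⁻¹ • b))
    rwa [smul_sub, smul_inv_smul, ← mul_smul, ← mul_smul] at this
  obtain ⟨c, hc⟩ := exists_scalar_of_mem_inertia hQ hτ
  refine ⟨mul_mem hconj (inv_mem (mul_mem hτ hτ)), fun a ha => ?_⟩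
  set b := (τ * τ)⁻¹ • a with hb
  have hbQ : b ∈ Q := smul_mem_of_mem_inertia (inv_mem (mul_mem hτ hτ)) ha
  have hab : a = (τ * τ) • b := by rw [hb, smul_inv_smul]
  rw [mul_smul, ← hb, hab]
  -- If `τ` acts on `Q / Q ^ 2` as the scalar `c`, its conjugate by `φ` acts as `φ c`, which
  -- Frobenius makes congruent to `c ^ 2`, the scalar of `τ * τ`.
  have h1 : φ • c - c * c ∈ Q := by
    have := hφ c
    rwa [hcard, pow_two] at this
  have h2 : (φ * τ * φ⁻¹) • b - φ • c * b ∈ Q ^ 2 := by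
    have := hmem2 _ (hc _ (hmem (inv_mem hst) b hbQ))
    rwa [smul_sub, smul_mul', smul_inv_smul, ← mul_smul, ← mul_smul] at this
  have h3 : (τ * τ) • b - c * c * b ∈ Q ^ 2 := by
    have := add_mem (hc _ (smul_mem_of_mem_inertia hτ hbQ)) (Ideal.mul_mem_left _ c (hc b hbQ))
    rw [← mul_smul] at this
    convert this using 1
    ring
  have := sub_mem (add_mem h2 (pow_two Q ▸ mul_mem_mul h1 hbQ : (φ • c - c * c) * b ∈ Q ^ 2)) h3
  convert this using 1
  ring

end Uniformizer

end WildInertia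

end Ideal

/-! ### Elements of `GL₂` in characteristic two -/

section GLTwo

variable {F : Type*} [Field F]

/-- Two vectors killed by the same nonzero `2 × 2` matrix are proportional. -/
theorem Matrix.exists_smul_eq_of_mulVec_eq_zero {N : Matrix (Fin 2) (Fin 2) F} (hN : N ≠ 0)
    {v z : Fin 2 → F} (hv : v ≠ 0) (hNv : N.mulVec v = 0) (hNz : N.mulVec z = 0) :
    ∃ c : F, z = c • v := by
  have hv' : ∀ i, N i 0 * v 0 + N i 1 * v 1 = 0 := fun i => by
    simpa [Matrix.mulVec, dotProduct] using congrFun hNv i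
  have hz' : ∀ i, N i 0 * z 0 + N i 1 * z 1 = 0 := fun i => by
    simpa [Matrix.mulVec, dotProduct] using congrFun hNz i
  have hdet : v 0 * z 1 - v 1 * z 0 = 0 := by
    by_contra hne
    refine hN ?_
    ext i j
    have h0 : N i 0 * (v 0 * z 1 - v 1 * z 0) = 0 := by
      linear_combination z 1 * hv' i - v 1 * hz' i
    have h1 : N i 1 * (v 0 * z 1 - v 1 * z 0) = 0 := by
      linear_combination v 0 * hz' i - z 0 * hv' i
    fin_cases j
    · exact (mul_eq_zero.1 h0).resolve_right hne
    · exact (mul_eq_zero.1 h1).resolve_right hne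
  by_cases h0 : v 0 = 0
  · have h1 : v 1 ≠ 0 := by
      intro h1
      refine hv ?_
      ext i
      fin_cases i <;> assumption
    refine ⟨z 1 / v 1, ?_⟩
    ext i
    fin_cases i
    · have : v 1 * z 0 = 0 := by linear_combination z 1 * h0 - hdet
      simp [h0, (mul_eq_zero.1 this).resolve_left h1]
    · simp [h1]
  · refine ⟨z 0 / v 0, ?_⟩
    ext i
    fin_cases i
    · simp [h0]
    · simp only [Pi.smul_apply, smul_eq_mul, Fin.mk_one]
      field_simp
      linear_combination hdet

variable [CharP F 2]

/-- Cayley–Hamilton reads `M ^ 2 + 1 = 0`, and `-1 = 1`. -/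
theorem Matrix.mul_self_eq_one_of_det_eq_one_of_trace_eq_zero {M : Matrix (Fin 2) (Fin 2) F}
    (hd : M.det = 1) (ht : M.trace = 0) : M * M = 1 := by
  have h2 : (2 : F) = 0 := CharTwo.two_eq_zero
  rw [Matrix.det_fin_two] at hd
  rw [Matrix.trace_fin_two] at ht
  ext i j
  fin_cases i <;> fin_cases j <;>
    simp only [Matrix.mul_apply, Fin.sum_univ_two, Matrix.one_apply, Fin.zero_eta, Fin.mk_one,
      Fin.isValue, ↓reduceIte, one_ne_zero, zero_ne_one]
  · linear_combination M 0 0 * ht - hd - h2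
  · linear_combination M 0 1 * ht
  · linear_combination M 1 0 * ht
  · linear_combination M 1 1 * ht - hd - h2

/-- The `2`-elements of `GL₂` in characteristic two are involutions. -/
theorem Matrix.GeneralLinearGroup.mul_self_eq_one_of_pow_two_pow
    {g : Matrix.GeneralLinearGroup (Fin 2) F} {k : ℕ} (hg : g ^ 2 ^ k = 1) : g * g = 1 := by
  apply Units.ext
  set M : Matrix (Fin 2) (Fin 2) F := (g : Matrix (Fin 2) (Fin 2) F) with hM
  have hpow : M ^ 2 ^ k = 1 := by rw [hM, ← Units.val_pow_eq_pow_val, hg, Units.val_one]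
  have h2 : (2 : F) = 0 := CharTwo.two_eq_zero
  -- In characteristic two, `(M - 1) ^ 2 ^ k = M ^ 2 ^ k - 1`.
  have hnil : IsNilpotent (M - 1) := ⟨2 ^ k, by
    rw [sub_pow_char_pow_of_commute 2 k (Commute.one_right M), hpow, one_pow, sub_self]⟩
  have htr := (Matrix.isNilpotent_trace_of_isNilpotent hnil).eq_zero
  have hdet : M.det = 1 := by
    have h1 : M.det ^ 2 ^ k = 1 := by rw [← Matrix.det_pow, hpow, Matrix.det_one]
    have h3 : (M.det - 1) ^ 2 ^ k = 0 := by rw [sub_pow_char_pow, h1, one_pow, sub_self]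
    exact sub_eq_zero.1 (pow_eq_zero_iff (by positivity) |>.1 h3)
  refine Matrix.mul_self_eq_one_of_det_eq_one_of_trace_eq_zero hdet ?_
  rw [Matrix.trace_sub, Matrix.trace_one, Fintype.card_fin] at htr
  push_cast at htr
  linear_combination htr + h2

/-- If conjugation by `φ` squares `τ` modulo a nontrivial `2`-subgroup of `GL₂` normalized by `φ`
and `τ`, in characteristic two, then `τ` is an involution. -/
theorem mul_self_eq_one_of_conj_eq_mul_self {G : Type*} [Group G]
    {ρ : G →* Matrix.GeneralLinearGroup (Fin 2) F} (hρ : Function.Injective ρ) (W : Subgroup G)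
    (hW : ∀ w ∈ W, w * w = 1) (hW1 : W ≠ ⊥) {φ τ : G} (hφ : ∀ w ∈ W, φ⁻¹ * w * φ ∈ W)
    (hτ : ∀ w ∈ W, τ⁻¹ * w * τ ∈ W) (hφτ : φ * τ * φ⁻¹ * (τ * τ)⁻¹ ∈ W) : τ * τ = 1 := by
  have h2 : (2 : F) = 0 := CharTwo.two_eq_zero
  let M : G → Matrix (Fin 2) (Fin 2) F := fun g => ρ g
  have hM : ∀ g g', M (g * g') = M g * M g' := fun g g' => by simp [M]
  have hM1 : M 1 = 1 := by simp [M]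
  have hMinj : ∀ {g}, M g = 1 → g = 1 := fun {g} h => hρ (by
    rw [map_one]; exact Units.ext h)
  have hsq : ∀ {c : F}, c * c = 1 → c = 1 := fun {c} hc => by
    have : (c - 1) * (c - 1) = 0 := by linear_combination hc + (1 - c) * h2
    simpa [sub_eq_zero] using this
  obtain ⟨w, hw, hw1⟩ := W.bot_or_exists_ne_one.resolve_left hW1
  have hN : M w - 1 ≠ 0 := fun h => hw1 (hMinj (sub_eq_zero.1 h))
  obtain ⟨u, hu⟩ : ∃ u, (M w - 1).mulVec u ≠ 0 := by
    by_contra! hall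
    exact hN (Matrix.ext_of_mulVec_single fun i => by rw [hall, Matrix.zero_mulVec])
  -- As `(w - 1) ^ 2 = 0` and `w ≠ 1`, the image vector `v` spans the fixed line of `w`. The
  -- commuting group `W` fixes `v`, so any `d` normalizing `W` maps `v` into that line.
  set v := (M w - 1).mulVec u with hv
  have hNN : (M w - 1) * (M w - 1) = 0 := by
    have h1 : M w * M w = 1 := by rw [← hM, hW w hw, hM1]
    have h3 : (M w - 1) * (M w - 1) = (2 : F) • (1 - M w) := by
      rw [two_smul, sub_mul, mul_sub, h1]
      simp only [mul_one, one_mul]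
      abel
    rw [h3, h2, zero_smul]
  have hfix : ∀ z, (M w).mulVec z = z ↔ (M w - 1).mulVec z = 0 := fun z => by
    rw [Matrix.sub_mulVec, Matrix.one_mulVec, sub_eq_zero]
  have hwv : (M w).mulVec v = v := by rw [hfix, hv, Matrix.mulVec_mulVec, hNN, Matrix.zero_mulVec]
  have hline : ∀ z, (M w).mulVec z = z → ∃ c : F, z = c • v := fun z hz =>
    Matrix.exists_smul_eq_of_mulVec_eq_zero hN hu ((hfix v).1 hwv) ((hfix z).1 hz)
  have hsmul : ∀ {c d : F}, c • v = d • v → c = d := fun h => smul_left_injective F hu h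
  have hWv : ∀ w' ∈ W, (M w').mulVec v = v := by
    intro w' hw'
    have hcomm : w * w' = w' * w := by
      have h1 := hW _ (mul_mem hw hw')
      have h3 := hW _ hw
      have h4 := hW _ hw'
      calc w * w' = (w' * w') * (w * w') * (w * w) := by rw [h3, h4]; simp
        _ = w' * ((w' * w) * (w' * w)) * w := by group
        _ = w' * w := by rw [hW _ (mul_mem hw' hw)]; simp
    obtain ⟨c, hc⟩ := hline ((M w').mulVec v) (by
      rw [Matrix.mulVec_mulVec, ← hM, hcomm, hM, ← Matrix.mulVec_mulVec, hwv])
    have h1 : (M w').mulVec ((M w').mulVec v) = v := by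
      rw [Matrix.mulVec_mulVec, ← hM, hW _ hw', hM1, Matrix.one_mulVec]
    rw [hc, Matrix.mulVec_smul, hc, smul_smul] at h1
    have h3 : c = 1 := hsq (hsmul (by rw [h1, one_smul]))
    rw [hc, h3, one_smul]
  have hstab : ∀ d, (∀ w ∈ W, d⁻¹ * w * d ∈ W) → ∃ c : F, (M d).mulVec v = c • v := by
    intro d hd
    refine hline _ ?_
    have h1 : w * d = d * (d⁻¹ * w * d) := by group
    rw [Matrix.mulVec_mulVec, ← hM, h1, hM, ← Matrix.mulVec_mulVec, hWv _ (hd w hw)]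
  obtain ⟨a, ha⟩ := hstab φ hφ
  obtain ⟨b, hb⟩ := hstab τ hτ
  have hne : ∀ {g : G} {c : F}, (M g).mulVec v = c • v → c ≠ 0 := by
    rintro g c hc rfl
    apply hu
    rw [← Matrix.one_mulVec v, ← hM1, ← inv_mul_cancel g, hM, ← Matrix.mulVec_mulVec, hc, zero_smul,
      Matrix.mulVec_zero]
  obtain ⟨w₀, hw₀⟩ : ∃ w₀, w₀ = φ * τ * φ⁻¹ * (τ * τ)⁻¹ := ⟨_, rfl⟩
  rw [← hw₀] at hφτ
  have hrel : φ * τ = w₀ * (τ * τ) * φ := by rw [hw₀]; group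
  -- Applying `φ τ = w₀ τ² φ` to the common eigenvector `v` gives `a b = a b ^ 2`.
  have hb1 : b = 1 := by
    have h1 : (M (φ * τ)).mulVec v = (b * a) • v := by
      rw [hM, ← Matrix.mulVec_mulVec, hb, Matrix.mulVec_smul, ha, smul_smul]
    have h3 : (M (w₀ * (τ * τ) * φ)).mulVec v = (a * (b * b)) • v := by
      rw [hM _ φ, hM w₀, hM τ, ← Matrix.mulVec_mulVec, ha, Matrix.mulVec_smul, ← Matrix.mulVec_mulVec,
        ← Matrix.mulVec_mulVec, hb, Matrix.mulVec_smul, hb, Matrix.mulVec_smul, Matrix.mulVec_smul,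
        hWv _ hφτ, smul_smul, smul_smul, mul_assoc]
    rw [hrel, h3] at h1
    have h4 := hsmul h1
    have h5 : (b - 1) * (a * b) = 0 := by linear_combination h4
    exact sub_eq_zero.1 ((mul_eq_zero.1 h5).resolve_right (mul_ne_zero (hne ha) (hne hb)))
  have hdet0 : ∀ g : G, (M g).det ≠ 0 := fun g h => by
    have := congrArg Matrix.det (hM g g⁻¹)
    rw [mul_inv_cancel, hM1, Matrix.det_one, Matrix.det_mul, h, zero_mul] at this
    exact one_ne_zero this
  have hdetτ : (M τ).det = 1 := by
    have h1 : (M w₀).det = 1 := hsq (by rw [← Matrix.det_mul, ← hM, hW _ hφτ, hM1, Matrix.det_one])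
    have h3 := congrArg (fun g => (M g).det) hrel
    simp only [hM, Matrix.det_mul, h1] at h3
    have h4 : ((M τ).det - 1) * ((M φ).det * (M τ).det) = 0 := by linear_combination -h3
    exact sub_eq_zero.1 ((mul_eq_zero.1 h4).resolve_right (mul_ne_zero (hdet0 _) (hdet0 _)))
  refine hMinj ?_
  rw [hM]
  refine Matrix.mul_self_eq_one_of_det_eq_one_of_trace_eq_zero hdetτ ?_
  -- With eigenvalue `1` and determinant `1`, `τ` is unipotent; comparing the two determinants shows
  -- that its trace is `0`.
  have hdet1 : (M τ - 1).det = 0 := by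
    refine Matrix.exists_mulVec_eq_zero_iff.1 ⟨v, hu, ?_⟩
    rw [Matrix.sub_mulVec, hb, hb1, one_smul, Matrix.one_mulVec, sub_self]
  rw [Matrix.det_fin_two] at hdet1 hdetτ
  simp only [Matrix.sub_apply, Matrix.one_apply, Fin.isValue, ↓reduceIte, one_ne_zero,
    zero_ne_one] at hdet1
  rw [Matrix.trace_fin_two]
  linear_combination hdetτ - hdet1 + h2

end GLTwo

/-! ### Exponent of the different and tame ramification above `2` -/

theorem Subgroup.sum_erase_one {G M : Type*} [Group G] [Fintype G] [AddCommMonoid M]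
    (J : Subgroup G) [Fintype J] [DecidableEq J] [DecidablePred fun g : G => g ∈ J ∧ g ≠ 1]
    (f : G → M) :
    ∑ g ∈ Finset.univ.erase (1 : J), f g = ∑ g : G with g ∈ J ∧ g ≠ 1, f g := by
  refine Finset.sum_bij (fun g _ => (g : G)) ?_ ?_ ?_ fun _ _ => rfl
  · intro g hg
    simpa using Finset.ne_of_mem_erase hg
  · intro g _ g' _ h
    exact Subtype.ext h
  · intro g hg
    obtain ⟨h1, h2⟩ := (Finset.mem_filter.1 hg).2
    exact ⟨⟨g, h1⟩, by simpa [Subtype.ext_iff] using h2, rfl⟩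

theorem Subgroup.exists_sylow_two_le {G : Type*} [Group G] [Finite G] {I W : Subgroup G}
    (hWI : W ≤ I) (hW : IsPGroup 2 W) {e m : ℕ} (he : Odd e) (hI : Nat.card I = e * 2 ^ m) :
    ∃ P : Subgroup G, W ≤ P ∧ P ≤ I ∧ IsPGroup 2 P ∧ Nat.card P = 2 ^ m := by
  have : Fact (Nat.Prime 2) := ⟨Nat.prime_two⟩
  obtain ⟨S, hS⟩ := (hW.comap_of_injective I.subtype I.subtype_injective).exists_le_sylow
  refine ⟨(S : Subgroup I).map I.subtype, ?_, Subgroup.map_subtype_le _, S.isPGroup'.map _, ?_⟩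
  · intro w hw
    exact ⟨⟨w, hWI hw⟩, hS hw, rfl⟩
  · rw [Subgroup.card_map_of_injective I.subtype_injective]
    have := S.card_eq_multiplicity
    rw [hI, Nat.factorization_mul he.pos.ne' (by positivity), Finsupp.add_apply,
      Nat.factorization_eq_zero_of_not_dvd he.not_two_dvd_nat, zero_add,
      Nat.Prime.factorization_pow Nat.prime_two, Finsupp.single_eq_same] at this
    exact this

section

variable {K L : Type*} [Field K] [NumberField K] [Field L] [NumberField L] [Algebra K L]
  [IsGalois K L]

/-- Bound for the exponent of the different at a prime above `2` when the wild inertia group has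
exponent two. -/
theorem two_mul_exponent_differentIdeal_le (w : HeightOneSpectrum (𝓞 L))
    (h2 : (2 : 𝓞 L) ∈ w.asIdeal) {e m : ℕ} (he : Odd e)
    (hI : Nat.card (w.asIdeal.inertia Gal(L/K)) = e * 2 ^ m)
    (hexp : ∀ (σ : Gal(L/K)) (k : ℕ), σ ^ 2 ^ k = 1 → σ * σ = 1)
    {T : ℕ} (hT : w.valuation L 2 = exp (-(T : ℤ))) {k : ℕ}
    (hk : w.asIdeal ^ k ∣ differentIdeal (𝓞 K) (𝓞 L)) :
    2 * 2 ^ m * (k : ℤ) ≤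
      2 * (2 ^ m) ^ 2 * ((e : ℤ) - 1) + 4 * (2 ^ m - 1) * T + (2 ^ m) ^ 2 := by
  classical
  have := Fintype.ofFinite Gal(L/K)
  have : FaithfulSMul Gal(L/K) (𝓞 L) := IsGaloisGroup.faithful (𝓞 K)
  obtain ⟨x, hx⟩ := w.intValuation_exists_uniformizer
  have hxL : w.valuation L (x : L) = exp (-1) := by
    rw [← hx]
    exact w.valuation_of_algebraMap x
  have hx1 : x ∈ w.asIdeal := by
    have := (w.intValuation_le_pow_iff_mem x 1).1 (by rw [hx]; simp)
    simpa using this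
  have hx2 : x ∉ w.asIdeal ^ 2 := fun h => by
    have := (w.intValuation_le_pow_iff_mem x 2).2 h
    rw [hx, exp_le_exp] at this
    norm_num at this
  obtain ⟨P, hWP, hPI, hP, hPcard⟩ := Subgroup.exists_sylow_two_le
    (Ideal.wildInertia_le_inertia (Q := w.asIdeal) (G := Gal(L/K)))
    (Ideal.isPGroup_wildInertia h2) he hI
  have hI' := le_sum_log_of_pow_dvd_differentIdeal w hxL hk rfl
  have hactP := isTotallyRamifiedAction_of_le_inertia w P hPI hxL
  have hP2 := hactP.sum_log_le_of_exponent_two (T := T) (fun g => by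
    obtain ⟨j, hj⟩ := hP g
    exact Subtype.ext (hexp g j (by simpa using congrArg Subtype.val hj))) hT
  set f : Gal(L/K) → ℤ := fun g => -log (w.valuation L ((x : L) - g • (x : L))) with hf
  have hI'' : (k : ℤ) ≤ ∑ g : Gal(L/K) with g ∈ w.asIdeal.inertia Gal(L/K) ∧ g ≠ 1, f g := by
    rw [← Subgroup.sum_erase_one]; exact hI'
  have hP3 : 2 * Nat.card P * ∑ g : Gal(L/K) with g ∈ P ∧ g ≠ 1, f g ≤
      4 * (Nat.card P - 1) * T + Nat.card P ^ 2 := by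
    rw [← Subgroup.sum_erase_one]; exact hP2
  have hsplit : ∑ g : Gal(L/K) with g ∈ w.asIdeal.inertia Gal(L/K) ∧ g ≠ 1, f g =
      (∑ g : Gal(L/K) with g ∈ P ∧ g ≠ 1, f g) +
        ∑ g : Gal(L/K) with g ∈ w.asIdeal.inertia Gal(L/K) ∧ g ∉ P, f g := by
    rw [← Finset.sum_union]
    · refine Finset.sum_congr (Finset.ext fun g => ?_) fun _ _ => rfl
      simp only [Finset.mem_filter, Finset.mem_univ, true_and, Finset.mem_union]
      constructor
      · rintro ⟨h1, h3⟩
        by_cases hg : g ∈ P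
        · exact Or.inl ⟨hg, h3⟩
        · exact Or.inr ⟨h1, hg⟩
      · rintro (⟨h1, h3⟩ | ⟨h1, h3⟩)
        · exact ⟨hPI h1, h3⟩
        · exact ⟨h1, fun h => h3 (h ▸ one_mem P)⟩
    · rw [Finset.disjoint_filter]
      exact fun g _ h1 h3 => h3.2 h1.1
  -- A value of at least `2` would put `g` in wild inertia, which lies in `P`.
  have htame : ∀ g ∈ Finset.univ.filter fun g : Gal(L/K) =>
      g ∈ w.asIdeal.inertia Gal(L/K) ∧ g ∉ P, f g ≤ 1 := by
    intro g hg
    obtain ⟨hgI, hgP⟩ := (Finset.mem_filter.1 hg).2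
    by_contra! hlt
    refine hgP (hWP (Ideal.mem_wildInertia_of_smul_sub_mem_sq w.ne_bot hx1 hx2 hgI ?_))
    rw [← neg_mem_iff, neg_sub, ← w.intValuation_le_pow_iff_mem, ← w.valuation_of_algebraMap (K := L)]
    refine le_exp_of_log_le ?_
    have : log (w.valuation L ((x : L) - g • (x : L))) ≤ -2 := by
      simp only [hf] at hlt; omega
    exact this
  have hcard : ((Finset.univ.filter fun g : Gal(L/K) =>
      g ∈ w.asIdeal.inertia Gal(L/K) ∧ g ∉ P).card : ℤ) = (e - 1) * 2 ^ m := by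
    have h1 : (Finset.univ.filter fun g : Gal(L/K) => g ∈ w.asIdeal.inertia Gal(L/K)).card =
        e * 2 ^ m := by
      rw [← hI, Nat.card_eq_fintype_card, Fintype.card_subtype]
    have h3 : (Finset.univ.filter fun g : Gal(L/K) => g ∈ P).card = 2 ^ m := by
      rw [← hPcard, Nat.card_eq_fintype_card, Fintype.card_subtype]
    have h4 : (Finset.univ.filter fun g : Gal(L/K) => g ∈ w.asIdeal.inertia Gal(L/K) ∧ g ∉ P) =
        (Finset.univ.filter fun g : Gal(L/K) => g ∈ w.asIdeal.inertia Gal(L/K)) \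
          (Finset.univ.filter fun g : Gal(L/K) => g ∈ P) := by
      ext g; simp
    rw [h4, Finset.cast_card_sdiff (fun g hg => by simp at hg ⊢; exact hPI hg), h1, h3]
    push_cast
    ring
  have hsum := Finset.sum_le_sum htame
  rw [Finset.sum_const, nsmul_eq_mul, mul_one, hcard] at hsum
  rw [hsplit] at hI''
  rw [hPcard] at hP3
  push_cast at hP3
  have hN : (0 : ℤ) < 2 ^ m := by positivity
  nlinarith [mul_le_mul_of_nonneg_left (hI''.trans (add_le_add_right hsum _)) hN.le]

open scoped Pointwise in
/-- If the residue field below is `𝔽₂` and the Galois group embeds into `GL₂` over a field of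
characteristic two, then wildly ramified primes above `2` have no tame ramification. -/
theorem eq_one_of_natCard_quotient_eq_two (Q : Ideal (𝓞 L)) [Q.IsPrime] (hQ : Q ≠ ⊥)
    (h2 : (2 : 𝓞 L) ∈ Q) {e m : ℕ} (he : Odd e) (hm : m ≠ 0)
    (hI : Nat.card (Q.inertia Gal(L/K)) = e * 2 ^ m)
    (hcard : Nat.card (𝓞 K ⧸ Q.under (𝓞 K)) = 2)
    {F : Type*} [Field F] [CharP F 2] {ρ : Gal(L/K) →* Matrix.GeneralLinearGroup (Fin 2) F}
    (hρ : Function.Injective ρ) : e = 1 := by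
  have : Fact (Nat.Prime 2) := ⟨Nat.prime_two⟩
  have : FaithfulSMul Gal(L/K) (𝓞 L) := IsGaloisGroup.faithful (𝓞 K)
  have hQmax : Q.IsMaximal := Ideal.IsPrime.isMaximal inferInstance hQ
  have : Finite (𝓞 L ⧸ Q) := Ring.HasFiniteQuotients.finiteQuotient hQ
  have hexp : ∀ (σ : Gal(L/K)) (k : ℕ), σ ^ 2 ^ k = 1 → σ * σ = 1 := fun σ k hσ => hρ (by
    rw [map_mul, map_one]
    exact Matrix.GeneralLinearGroup.mul_self_eq_one_of_pow_two_pow (k := k)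
      (by rw [← map_pow, hσ, map_one]))
  have hWp : IsPGroup 2 (Q.wildInertia Gal(L/K)) := Ideal.isPGroup_wildInertia h2
  have hW : ∀ w ∈ Q.wildInertia Gal(L/K), w * w = 1 := fun w hw => by
    obtain ⟨j, hj⟩ := hWp ⟨w, hw⟩
    exact hexp w j (by simpa using congrArg Subtype.val hj)
  -- Here `m ≠ 0` matters: Cauchy's theorem gives an involution in inertia, and such involutions are
  -- wild.
  have hW1 : Q.wildInertia Gal(L/K) ≠ ⊥ := by
    intro hbot
    obtain ⟨σ, hσ⟩ := exists_prime_orderOf_dvd_card' (G := Q.inertia Gal(L/K)) 2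
      (by rw [hI]; exact Dvd.dvd.mul_left (dvd_pow_self 2 hm) e)
    have hmem := Ideal.mem_wildInertia_of_sq_eq_one hQ h2 σ.2 (by
      have := pow_orderOf_eq_one σ
      rw [hσ, pow_two] at this
      exact congrArg Subtype.val this)
    rw [hbot, Subgroup.mem_bot] at hmem
    have : σ = 1 := Subtype.ext hmem
    rw [this, orderOf_one] at hσ
    omega
  obtain ⟨φ, hφ⟩ := IsArithFrobAt.exists_of_isInvariant (𝓞 K) Gal(L/K) Q
  have hnorm : ∀ {d : Gal(L/K)}, d ∈ MulAction.stabilizer Gal(L/K) Q →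
      ∀ w ∈ Q.wildInertia Gal(L/K), d⁻¹ * w * d ∈ Q.wildInertia Gal(L/K) := fun hd w hw => by
    simpa using Ideal.conj_mem_wildInertia (inv_mem hd) hw
  have hinv : ∀ τ ∈ Q.inertia Gal(L/K), τ * τ = 1 := fun τ hτ =>
    mul_self_eq_one_of_conj_eq_mul_self hρ _ hW hW1 (hnorm hφ.mem_stabilizer)
      (hnorm (Ideal.inertia_le_stabilizer Q hτ))
      (Ideal.frobenius_conj_mem_wildInertia hQ hcard hφ hτ)
  have hIp : IsPGroup 2 (Q.inertia Gal(L/K)) := fun τ =>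
    ⟨1, Subtype.ext (by simpa [pow_two] using hinv τ τ.2)⟩
  obtain ⟨j, hj⟩ := IsPGroup.iff_card.1 hIp
  rw [hI] at hj
  obtain ⟨i, -, rfl⟩ := (Nat.dvd_prime_pow Nat.prime_two).1 ⟨2 ^ m, hj.symm⟩
  rcases Nat.eq_zero_or_pos i with rfl | hi
  · rfl
  · exact absurd he (Nat.not_odd_iff_even.2 ((Nat.even_pow.2 ⟨even_two, hi.ne'⟩)))

end

/-! ### From local exponents to discriminants -/

/-- Globalizes the local bound with denominators cleared: where `J` has exponent `T`, `D` has
exponent at most `d / M`. It is used with `D` the different and `J = (2)`. -/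
theorem Ideal.pow_dvd_pow_of_forall_heightOneSpectrum {B : Type*} [CommRing B] [IsDedekindDomain B]
    {D J : Ideal B} (hD : D ≠ 0) {M T d : ℕ}
    (hDJ : ∀ w : HeightOneSpectrum B, w.asIdeal ∣ D → w.asIdeal ∣ J)
    (hJ : ∀ w : HeightOneSpectrum B, w.asIdeal ∣ J → emultiplicity w.asIdeal J = T)
    (hle : ∀ w : HeightOneSpectrum B, w.asIdeal ∣ J → ∀ k : ℕ, w.asIdeal ^ k ∣ D → M * k ≤ d) :
    D ^ (M * T) ∣ J ^ d := by
  rw [UniqueFactorizationMonoid.dvd_iff_emultiplicity_le (pow_ne_zero _ hD)]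
  intro p hp
  let w : HeightOneSpectrum B := ⟨p, Ideal.isPrime_of_prime hp, hp.ne_zero⟩
  rw [emultiplicity_pow hp, emultiplicity_pow hp]
  by_cases hpD : p ∣ D
  · have hfin : FiniteMultiplicity p D := FiniteMultiplicity.of_prime_left hp hD
    rw [hJ w (hDJ w hpD), hfin.emultiplicity_eq_multiplicity]
    have := hle w (hDJ w hpD) _ (pow_multiplicity_dvd p D)
    calc ((M * T : ℕ) : ℕ∞) * (multiplicity p D : ℕ) = ((M * multiplicity p D * T : ℕ) : ℕ∞) := by
          push_cast; ring
      _ ≤ ((d * T : ℕ) : ℕ∞) := by exact_mod_cast Nat.mul_le_mul_right T this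
      _ = _ := by push_cast; ring
  · rw [emultiplicity_eq_zero.2 hpD, mul_zero]
    exact zero_le

theorem le_two_rpow_of_pow_le {A X d n : ℕ} (hX : X ≠ 0) (h : A ^ X ≤ (2 ^ (2 * n)) ^ d) :
    (A : ℝ) ≤ (2 : ℝ) ^ (2 * ((d : ℝ) / X) * n) := by
  have hX' : (X : ℝ) ≠ 0 := by exact_mod_cast hX
  refine le_of_pow_le_pow_left₀ hX (by positivity) ?_
  rw [← Real.rpow_natCast (2 ^ _), ← Real.rpow_mul (by norm_num)]
  have h1 : 2 * ((d : ℝ) / X) * n * X = ((2 * n * d : ℕ) : ℝ) := by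
    push_cast; field_simp
  rw [h1, Real.rpow_natCast, pow_mul]
  exact_mod_cast h

theorem absNorm_span_two (F : Type*) [Field F] [NumberField F] :
    Ideal.absNorm (Ideal.span {(2 : 𝓞 F)}) = 2 ^ Module.finrank ℚ F := by
  rw [Ideal.absNorm_span_singleton]
  have h : Algebra.norm ℤ (algebraMap ℤ (𝓞 F) 2) = 2 ^ Module.finrank ℤ (𝓞 F) :=
    Algebra.norm_algebraMap 2
  rw [map_ofNat] at h
  rw [h, RingOfIntegers.rank, Int.natAbs_pow]
  rfl

/-- A prime of a quadratic field ramified above `2` is unique, has square `(2)` and norm `2`. -/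
theorem TwoRamifiesIn.exists_sq_eq_span {K : Type*} [Field K] [NumberField K]
    (hK : Module.finrank ℚ K = 2) (h : TwoRamifiesIn K) :
    ∃ p : Ideal (𝓞 K), p.IsMaximal ∧ p ^ 2 = Ideal.span {(2 : 𝓞 K)} ∧ Ideal.absNorm p = 2 := by
  obtain ⟨p, hp, h2, hram⟩ := h
  have hp0 : p ≠ ⊥ := fun h => by
    rw [h, Ideal.mem_bot] at h2
    exact two_ne_zero h2
  have hmax : p.IsMaximal := hp.isMaximal hp0
  have hle : Ideal.span {(2 : 𝓞 K)} ≤ p ^ 2 := by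
    have hne : p.under ℤ ≠ ⊥ := mt Ideal.eq_bot_of_comap_eq_bot hp0
    have h1 := Ideal.le_pow_ramificationIdx' (p := p.under ℤ) (P := p)
    rw [Ideal.ramificationIdx'_eq_ramificationIdx _ _ hne] at h1
    rw [Ideal.span_singleton_le_iff_mem]
    refine Ideal.pow_le_pow_right hram (h1 ?_)
    have h3 : (2 : ℤ) ∈ p.under ℤ := by
      rw [Ideal.under_def, Ideal.mem_comap]
      simpa using h2
    simpa using Ideal.mem_map_of_mem (algebraMap ℤ (𝓞 K)) h3
  have hdvd := Ideal.absNorm_dvd_absNorm_of_le hle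
  rw [map_pow, absNorm_span_two, hK, Nat.pow_dvd_pow_iff two_ne_zero] at hdvd
  have hnorm : Ideal.absNorm p = 2 :=
    ((Nat.dvd_prime Nat.prime_two).1 hdvd).resolve_left
      fun h => hp.ne_top (Ideal.absNorm_eq_one_iff.1 h)
  refine ⟨p, hmax, ?_, hnorm⟩
  obtain ⟨J, hJ⟩ := Ideal.dvd_iff_le.2 hle
  have hJ1 := congrArg Ideal.absNorm hJ
  rw [absNorm_span_two, hK, map_mul, map_pow, hnorm] at hJ1
  have : J = 1 := by
    rw [Ideal.one_eq_top, ← Ideal.absNorm_eq_one_iff]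
    omega
  rw [hJ, this, mul_one]

section

variable {K L : Type*} [Field K] [Field L] [NumberField L] [Algebra K L]

theorem emultiplicity_map_eq_ramificationIdx (w : HeightOneSpectrum (𝓞 L)) :
    emultiplicity w.asIdeal ((w.asIdeal.under (𝓞 K)).map (algebraMap (𝓞 K) (𝓞 L))) =
      w.asIdeal.ramificationIdx (𝓞 K) := by
  have hne : w.asIdeal.under (𝓞 K) ≠ ⊥ := mt Ideal.eq_bot_of_comap_eq_bot w.ne_bot
  have hmap : (w.asIdeal.under (𝓞 K)).map (algebraMap (𝓞 K) (𝓞 L)) ≠ ⊥ :=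
    Ideal.map_ne_bot_of_ne_bot hne
  rw [Ideal.IsDedekindDomain.ramificationIdx_eq_multiplicity (w.asIdeal.under (𝓞 K)) w.asIdeal hmap]
  exact (FiniteMultiplicity.of_prime_left w.prime hmap).emultiplicity_eq_multiplicity

variable [NumberField K] [IsGalois K L]

/-- Discriminant bound for a Galois extension, unramified outside `2`, whose Galois group has
involutions as its only `2`-elements. -/
theorem abs_discr_le_of_forall_emultiplicity (hK : Module.finrank ℚ K = 2)
    (hodd : ∀ Q : Ideal (𝓞 L), Q.IsPrime → Q ≠ ⊥ → (2 : 𝓞 L) ∉ Q → Q.ramificationIdx (𝓞 K) = 1)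
    {e m T d : ℕ} (he : Odd e) (hT0 : T ≠ 0)
    (htwo : ∀ Q : Ideal (𝓞 L), Q.IsPrime → (2 : 𝓞 L) ∈ Q → Q.ramificationIdx (𝓞 K) = e * 2 ^ m)
    (hexp : ∀ (σ : Gal(L/K)) (k : ℕ), σ ^ 2 ^ k = 1 → σ * σ = 1)
    (hT : ∀ w : HeightOneSpectrum (𝓞 L), (2 : 𝓞 L) ∈ w.asIdeal →
      emultiplicity w.asIdeal (Ideal.span {(2 : 𝓞 L)}) = T)
    (hd : (d : ℤ) = 2 * (2 ^ m) ^ 2 * ((e : ℤ) - 1) + 4 * (2 ^ m - 1) * T + (2 ^ m) ^ 2) :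
    |(discr L : ℝ)| ≤ |(discr K : ℝ)| ^ Module.finrank K L *
      (2 : ℝ) ^ (2 * ((d : ℝ) / (2 * 2 ^ m * T : ℕ)) * Module.finrank K L) := by
  have h20 : (2 : 𝓞 L) ≠ 0 := two_ne_zero
  have hmem : ∀ w : HeightOneSpectrum (𝓞 L),
      w.asIdeal ∣ Ideal.span {(2 : 𝓞 L)} ↔ (2 : 𝓞 L) ∈ w.asIdeal := fun w => by
    rw [Ideal.dvd_iff_le, Ideal.span_singleton_le_iff_mem]
  have hdvd : differentIdeal (𝓞 K) (𝓞 L) ^ (2 * 2 ^ m * T) ∣ Ideal.span {(2 : 𝓞 L)} ^ d := by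
    refine Ideal.pow_dvd_pow_of_forall_heightOneSpectrum differentIdeal_ne_bot ?_ ?_ ?_
    · intro w hw
      rw [hmem]
      by_contra h2
      exact (not_dvd_differentIdeal_iff (A := 𝓞 K)).2
        (Ideal.ramificationIdx_eq_one_iff.1 (hodd _ w.isPrime w.ne_bot h2)) hw
    · exact fun w hw => hT w ((hmem w).1 hw)
    · intro w hw k hk
      rw [hmem] at hw
      have hval : w.valuation L 2 = exp (-(T : ℤ)) := by
        have h1 : w.valuation L (algebraMap (𝓞 L) L 2) = exp (-(T : ℤ)) := by
          rw [w.valuation_of_algebraMap, w.intValuation_eq_exp_neg_multiplicity h20,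
            multiplicity_eq_of_emultiplicity_eq_some (hT w hw)]
        rwa [map_ofNat] at h1
      have hI : Nat.card (w.asIdeal.inertia Gal(L/K)) = e * 2 ^ m := by
        rw [natCard_inertia_eq_ramificationIdx, htwo _ w.isPrime hw]
      have := two_mul_exponent_differentIdeal_le w hw he hI hexp hval hk
      rw [← hd] at this
      exact_mod_cast this
  have hnorm := Nat.le_of_dvd (by
      rw [Nat.pos_iff_ne_zero, Ne, Ideal.absNorm_eq_zero_iff]
      exact pow_ne_zero _ (by simp))
    (Ideal.absNorm_dvd_absNorm_of_le (Ideal.le_of_dvd hdvd))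
  -- The ideal `(2)` of `𝓞 L` has norm `2 ^ (2 * n)`; this is the source of the factor `2 n` in the
  -- exponent.
  rw [map_pow, map_pow, absNorm_span_two, ← Module.finrank_mul_finrank ℚ K L, hK] at hnorm
  have hdiscr := natAbs_discr_eq_absNorm_differentIdeal_mul_natAbs_discr_pow K (𝓞 K) L (𝓞 L)
  have hdiscr' : |(discr L : ℝ)| = (Ideal.absNorm (differentIdeal (𝓞 K) (𝓞 L)) : ℝ) *
      |(discr K : ℝ)| ^ Module.finrank K L := by
    have := congrArg (Nat.cast : ℕ → ℝ) hdiscr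
    rwa [Nat.cast_mul, Nat.cast_pow, Nat.cast_natAbs, Nat.cast_natAbs, Int.cast_abs,
      Int.cast_abs] at this
  rw [hdiscr', mul_comm]
  exact mul_le_mul_of_nonneg_left
    (le_two_rpow_of_pow_le (by positivity) hnorm) (by positivity)

end

theorem proposition1
    (K : Type*) [Field K] [NumberField K]
    (L : Type*) [Field L] [NumberField L] [Algebra K L]
    -- `K` is a quadratic field and `L / K` is Galois of degree `n`
    (hK : Module.finrank ℚ K = 2) [IsGalois K L]
    (n : ℕ) (hn : Module.finrank K L = n)
    -- `L / K` is unramified at all primes not above `2`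
    (hodd : ∀ Q : Ideal (𝓞 L), Q.IsPrime → Q ≠ ⊥ → (2 : 𝓞 L) ∉ Q →
      Q.ramificationIdx (𝓞 K) = 1)
    -- the ramification index of `L / K` above `2` is `e * 2 ^ m`
    (e m : ℕ) (he : Odd e) (hm : 1 ≤ m)
    (htwo : ∀ Q : Ideal (𝓞 L), Q.IsPrime → (2 : 𝓞 L) ∈ Q →
      Q.ramificationIdx (𝓞 K) = e * 2 ^ m)
    -- the Galois group embeds into the group `GL₂` over a finite field of characteristic `2`
    (a : ℕ) (ha : a ≠ 0)
    (ρ : Gal(L/K) →* Matrix.GeneralLinearGroup (Fin 2) (GaloisField 2 a))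
    (hρ : Function.Injective ρ) :
    (TwoRamifiesIn K → ∃ c : ℝ, c ≤ 9 / 4 - 1 / 2 ^ (m - 1) ∧
      |(discr L : ℝ)| ≤ |(discr K : ℝ)| ^ n * (2 : ℝ) ^ (2 * c * n)) ∧
    (TwoStaysPrimeIn K → ∃ c : ℝ, c ≤ 3 - 1 / 2 ^ (m - 1) - 1 / (e * 2 ^ m) ∧
      |(discr L : ℝ)| ≤ |(discr K : ℝ)| ^ n * (2 : ℝ) ^ (2 * c * n)) := by
  subst hn
  have hexp : ∀ (σ : Gal(L/K)) (k : ℕ), σ ^ 2 ^ k = 1 → σ * σ = 1 := fun σ k hσ => hρ (by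
    rw [map_mul, map_one]
    exact Matrix.GeneralLinearGroup.mul_self_eq_one_of_pow_two_pow (k := k)
      (by rw [← map_pow, hσ, map_one]))
  have hspan : (Ideal.span {(2 : 𝓞 K)}).map (algebraMap (𝓞 K) (𝓞 L)) = Ideal.span {(2 : 𝓞 L)} := by
    rw [Ideal.map_span, Set.image_singleton, map_ofNat]
  have hunder : ∀ w : HeightOneSpectrum (𝓞 L), (2 : 𝓞 L) ∈ w.asIdeal →
      Ideal.span {(2 : 𝓞 K)} ≤ w.asIdeal.under (𝓞 K) := fun w hw => by
    rw [Ideal.span_singleton_le_iff_mem, Ideal.under_def, Ideal.mem_comap, map_ofNat]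
    exact hw
  obtain ⟨m, rfl⟩ : ∃ j, m = j + 1 := ⟨m - 1, by omega⟩
  have hpow : (1 : ℝ) ≤ 2 ^ m := one_le_pow₀ (by norm_num)
  have hpowZ : (1 : ℤ) ≤ 2 ^ m := one_le_pow₀ (by norm_num)
  have he1 : 1 ≤ e := he.pos
  rw [Nat.add_sub_cancel]
  constructor
  · intro h
    obtain ⟨p, hp, hp2, hpN⟩ := h.exists_sq_eq_span hK
    have hunder' : ∀ w : HeightOneSpectrum (𝓞 L), (2 : 𝓞 L) ∈ w.asIdeal →
        w.asIdeal.under (𝓞 K) = p := fun w hw => by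
      refine (hp.eq_of_le (Ideal.IsPrime.ne_top inferInstance) ?_).symm
      exact Ideal.IsPrime.le_of_pow_le (hp2.trans_le (hunder w hw))
    obtain ⟨w, hw⟩ : ∃ w : HeightOneSpectrum (𝓞 L), (2 : 𝓞 L) ∈ w.asIdeal := by
      have htop : Ideal.span {(2 : 𝓞 L)} ≠ ⊤ := by
        rw [Ne, ← Ideal.absNorm_eq_one_iff, absNorm_span_two]
        exact (Nat.one_lt_two_pow Module.finrank_pos.ne').ne'
      obtain ⟨Q, hQ, hle⟩ := Ideal.exists_le_maximal _ htop
      rw [Ideal.span_singleton_le_iff_mem] at hle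
      refine ⟨⟨Q, hQ.isPrime, fun h0 => two_ne_zero (α := 𝓞 L) ?_⟩, hle⟩
      rwa [h0, Ideal.mem_bot] at hle
    -- Without this, the local bound with `T = 2 e 2 ^ (m + 1)` would only give `c = 5/2 - 1/(4e) -
    -- 1/2 ^ m`, which is too large when `e > 1`.
    have he' : e = 1 := by
      have hcard : Nat.card (𝓞 K ⧸ w.asIdeal.under (𝓞 K)) = 2 := by
        rw [hunder' w hw, ← hpN]
        rfl
      exact eq_one_of_natCard_quotient_eq_two w.asIdeal w.ne_bot hw he (by omega : m + 1 ≠ 0)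
        (by rw [natCard_inertia_eq_ramificationIdx, htwo _ w.isPrime hw]) hcard hρ
    subst he'
    have hT : ∀ w : HeightOneSpectrum (𝓞 L), (2 : 𝓞 L) ∈ w.asIdeal →
        emultiplicity w.asIdeal (Ideal.span {(2 : 𝓞 L)}) = (2 * 2 ^ (m + 1) : ℕ) := fun w hw => by
      rw [← hspan, ← hp2, Ideal.map_pow, emultiplicity_pow w.prime, ← hunder' w hw,
        emultiplicity_map_eq_ramificationIdx, htwo _ w.isPrime hw, one_mul]
      push_cast
      rfl
    -- The tame term of `d` vanishes for `e = 1`, and `c` equals the claimed bound exactly.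
    refine ⟨_, ?_, abs_discr_le_of_forall_emultiplicity hK hodd he (by positivity) htwo hexp hT
      (d := 4 * (2 ^ (m + 1) - 1) * (2 * 2 ^ (m + 1)) + (2 ^ (m + 1)) ^ 2) ?_⟩
    · rw [Nat.cast_add, Nat.cast_mul, Nat.cast_mul, Nat.cast_sub Nat.one_le_two_pow]
      push_cast
      apply le_of_eq
      field_simp
      ring
    · rw [Nat.cast_add, Nat.cast_mul, Nat.cast_mul, Nat.cast_sub Nat.one_le_two_pow]
      push_cast
      ring
  · intro h
    have hT : ∀ w : HeightOneSpectrum (𝓞 L), (2 : 𝓞 L) ∈ w.asIdeal →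
        emultiplicity w.asIdeal (Ideal.span {(2 : 𝓞 L)}) = (e * 2 ^ (m + 1) : ℕ) := fun w hw => by
      have hmax : (Ideal.span {(2 : 𝓞 K)}).IsMaximal :=
        Ideal.IsPrime.isMaximal h (by simp)
      rw [← hspan, hmax.eq_of_le (Ideal.IsPrime.ne_top inferInstance) (hunder w hw),
        emultiplicity_map_eq_ramificationIdx, htwo _ w.isPrime hw]
    refine ⟨_, ?_, abs_discr_le_of_forall_emultiplicity hK hodd he (by positivity) htwo hexp hT
      (d := 2 * (2 ^ (m + 1)) ^ 2 * (e - 1) + 4 * (2 ^ (m + 1) - 1) * (e * 2 ^ (m + 1)) +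
        (2 ^ (m + 1)) ^ 2) ?_⟩
    · rw [Nat.cast_add, Nat.cast_add, Nat.cast_mul, Nat.cast_mul, Nat.cast_mul, Nat.cast_mul,
        Nat.cast_sub Nat.one_le_two_pow, Nat.cast_sub he1]
      push_cast
      have he0 : (1 : ℝ) ≤ e := by exact_mod_cast he1
      rw [← sub_nonneg]
      -- The local bound gives `c = 3 - 1/2 ^ m - 1/(2e)`, so the slack is nonnegative and vanishes
      -- only for `m = 0`, that is, wild part of order `2`.
      have : 3 - 1 / 2 ^ m - 1 / ((e : ℝ) * 2 ^ (m + 1)) -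
          (2 * (2 ^ (m + 1)) ^ 2 * ((e : ℝ) - 1) + 4 * (2 ^ (m + 1) - 1) * (e * 2 ^ (m + 1)) +
            (2 ^ (m + 1)) ^ 2) / (2 * 2 ^ (m + 1) * (e * 2 ^ (m + 1))) =
          (2 ^ m - 1) / (2 * (e * 2 ^ m)) := by
        field_simp
        ring
      rw [this]
      have : (0 : ℝ) ≤ 2 ^ m - 1 := by linarith
      positivity
    · rw [Nat.cast_add, Nat.cast_add, Nat.cast_mul, Nat.cast_mul, Nat.cast_mul, Nat.cast_mul,
        Nat.cast_sub Nat.one_le_two_pow, Nat.cast_sub he1]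
      push_cast
      ring
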